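/- Let $d\in\{2,3\}$, let $\mathbb{R}^d_*:=\mathbb{R}^d\setminus\{0\}$, and let $\omega\in\mathcal{C}^2(\mathbb{R}^d_*,\mathbb{R})$. Assume that there exist $i,j\in\{1,\dots,d\}$, $i\neq j$, such that the family $(1,\partial_i\omega,\partial_j\omega)$ is linearly independent in $\mathcal{C}^1(\mathbb{R}^d_*)$. Let $$A:=\{(v,v_*)\in(\mathbb{R}^d_*)^2:\ \nabla\omega(v)\neq\nabla\omega(v_*)\},$$ and assume that the boundary of $A$ in $(\mathbb{R}^d_*)^2$ has Lebesgue measure zero. For $(\bar v,\bar v_*)\in A$, a local parametrization at $(\bar v,\bar v_*)$ is a triple $(U,V,\psi)$ consisting of a bounded neighborhood $U\subset A$ of $(\bar v,\bar v_*)$, a neighborhood $V\subset\mathbb{R}^{d-1}$ of $0$ and a function $\psi\in\mathcal{C}^2(\mathbb{R}^d\times\mathbb{R}^d\times\mathbb{R}^{d-1},\mathbb{R}^d)$ such that, for all $(v,v_*)\in U$ and all $\sigma\in V$, one has $\psi(v,v_*,0)=0$, the points $v-\psi(v,v_*,\sigma)$ and $v_*+\psi(v,v_*,\sigma)$ are in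 $\mathbb{R}^d_*$, $$\omega(v)+\omega(v_*)=\omega(v-\psi(v,v_*,\sigma))+\omega(v_*+\psi(v,v_*,\sigma)),$$ and $\operatorname{rank}(D_\sigma\psi(v,v_*,0))=d-1$. Let $g\in L^1_{loc}(\mathbb{R}^d,\mathbb{R})$. Assume that for every $(\bar v,\bar v_*)\in A$ there is a local parametrization $(U,V,\psi)$ at $(\bar v,\bar v_*)$ such that, for almost every $(v,v_*)\in U$ and almost every $\sigma\in V$, $$g(v)+g(v_*)=g(v-\psi(v,v_*,\sigma))+g(v_*+\psi(v,v_*,\sigma)).$$ Then there exist $a,c\in\mathbb{R}$ and $b\in\mathbb{R}^d$ such that, for almost every $v\in\mathbb{R}^d_*$, $$g(v)=a+b\cdot v+c\,\omega(v).$$ -/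

import Mathlib

open MeasureTheory Topology

/-- The Euclidean space `ℝ^d`. -/
abbrev Vel (d : ℕ) : Type := EuclideanSpace ℝ (Fin d)

/-- The set `(ℝ^d ∖ {0})²`. -/
def puncturedPairs (d : ℕ) : Set (Vel d × Vel d) :=
  {p | p.1 ≠ 0 ∧ p.2 ≠ 0}

/-- The set `A` of the pairs `(v, v_*)` in `(ℝ^d ∖ {0})²` with `∇ω(v) ≠ ∇ω(v_*)`. -/
noncomputable def collisionSet {d : ℕ} (ω : Vel d → ℝ) : Set (Vel d × Vel d) :=
  {p | p ∈ puncturedPairs d ∧ gradient ω p.1 ≠ gradient ω p.2}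

/-- The partial derivative `∂_i ω` as a function on `ℝ^d ∖ {0}`. -/
noncomputable def partialDeriv {d : ℕ} (ω : Vel d → ℝ) (i : Fin d) :
    {v : Vel d // v ≠ 0} → ℝ :=
  fun v => fderiv ℝ ω v.1 (EuclideanSpace.single i 1)

/-- `(U, V, ψ)` is a local parametrization of the collision manifold around `p = (v̄, v̄_*)`:
`U ⊆ A` is a bounded neighborhood of `p`, `V ⊆ ℝ^(d-1)` is a neighborhood of `0`, and `ψ` is a
function of class `C²` such that, on `U × V`, `ψ(v, v_*, 0) = 0` and
`ω(v) + ω(v_*) = ω(v - ψ) + ω(v_* + ψ)` (both points lying in the domain `ℝ^d ∖ {0}` of `ω`),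
and `D_σ ψ(v, v_*, 0)` has rank `d - 1` for all `(v, v_*)` in `U`. -/
structure IsCollisionParam {d : ℕ} (ω : Vel d → ℝ) (p : Vel d × Vel d)
    (U : Set (Vel d × Vel d)) (V : Set (Vel (d - 1)))
    (ψ : Vel d × Vel d × Vel (d - 1) → Vel d) : Prop where
  nhds_U : U ∈ 𝓝 p
  bounded_U : Bornology.IsBounded U
  subset_U : U ⊆ collisionSet ω
  nhds_V : V ∈ 𝓝 (0 : Vel (d - 1))
  contDiff : ContDiff ℝ 2 ψ
  map_zero : ∀ v w, (v, w) ∈ U → ψ (v, w, 0) = 0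
  mem_domain : ∀ v w σ, (v, w) ∈ U → σ ∈ V →
    v - ψ (v, w, σ) ≠ 0 ∧ w + ψ (v, w, σ) ≠ 0
  conserve : ∀ v w σ, (v, w) ∈ U → σ ∈ V →
    ω v + ω w = ω (v - ψ (v, w, σ)) + ω (w + ψ (v, w, σ))
  rank_eq : ∀ v w, (v, w) ∈ U →
    (fderiv ℝ (fun σ : Vel (d - 1) => ψ (v, w, σ)) 0).toLinearMap.rank = ((d - 1 : ℕ) : Cardinal)

/-- The almost everywhere collision invariance of `g`: around every point of `A` there is a local
parametrization `(U, V, ψ)` of the collision manifold such that, for almost every `(v, v_*)` in `U`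
and almost every `σ` in `V`, `g(v) + g(v_*) = g(v - ψ) + g(v_* + ψ)`. -/
def IsAECollisionInvariant {d : ℕ} (ω g : Vel d → ℝ) : Prop :=
  ∀ p ∈ collisionSet ω, ∃ (U : Set (Vel d × Vel d)) (V : Set (Vel (d - 1)))
    (ψ : Vel d × Vel d × Vel (d - 1) → Vel d),
    IsCollisionParam ω p U V ψ ∧
    ∀ᵐ q : Vel d × Vel d, q ∈ U → ∀ᵐ σ : Vel (d - 1), σ ∈ V →
      g q.1 + g q.2 = g (q.1 - ψ (q.1, q.2, σ)) + g (q.2 + ψ (q.1, q.2, σ))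

/-! ### The determinant near the identity -/

section Determinant

variable {E : Type*} [NormedAddCommGroup E] [NormedSpace ℝ E] [FiniteDimensional ℝ E]

/-! Write δ_a = ∂_aω(v) - ∂_aω(v_*). At σ = 0 the admissible displacements of (v, v_*) are the (-y,
y) with y in the kernel of ∇ω(v) - ∇ω(v_*), so for all directions a, b the field Z = δ_a (b, -b) -
δ_b (a, -a) is tangent to the collision manifolds. It is divergence free because the Hessian of ω is
symmetric. Differentiating the invariance of G(v, v_*) = g(v) + g(v_*) at σ = 0 should thus give ∫ G
Zχ = 0. As g is only locally integrable, the derivative is put on the test function: change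
variables by the near-identity map (v, v_*) ↦ (v - ψ, v_* + ψ) and differentiate in σ the integral
carrying the Jacobian (`integral_mul_trace_fderiv_eq_zero`).

This gives the identity for χ supported in A. Since Z vanishes where δ_a = δ_b = 0, cutting off near
that set leaves no error in the limit, and the identity holds for all χ supported in the punctured
pairs (`integral_mul_collisionForm_eq_zero`).

Products χ = φ(v) φ'(v_*) are now allowed. By Fubini the identity becomes a symmetric bilinear
relation between the functionals ∫ φ, ∫ ∂_aω φ, ∫ ∂_bω φ and weak derivatives
(`symmetricRelation_of_invariant`). For a = e_i, b = e_j the first three are independent, and a dual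
test function isolates ∂_i g as a combination of 1 and ∂_iω; the relation for (e_i, e) then gives
∂_e g for every e with the same coefficient of ∂_eω (`exists_weakDeriv_eq`). Hence g minus a
multiple of ω and a linear form has zero weak gradient on the connected set ℝ^d ∖ {0}. -/

theorem contDiff_clm_det {n : WithTop ℕ∞} : ContDiff ℝ n (fun A : E →L[ℝ] E => A.det) := by
  let b := Module.finBasis ℝ E
  have h : (fun A : E →L[ℝ] E => A.det) = fun A : E →L[ℝ] E =>
      ∑ s : Equiv.Perm (Fin (Module.finrank ℝ E)),
        ((Equiv.Perm.sign s : ℤ) : ℝ) * ∏ i, b.coord (s i) (A (b i)) := by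
    funext A
    rw [ContinuousLinearMap.det, ← LinearMap.det_toMatrix b, Matrix.det_apply']
    simp [LinearMap.toMatrix_apply]
  rw [h]
  refine ContDiff.sum fun s _ => contDiff_const.mul (contDiff_prod fun i _ => ?_)
  exact ((b.coord (s i)).toContinuousLinearMap.contDiff).comp
    (ContinuousLinearMap.apply ℝ E (b i)).contDiff

/-- det(1 + tT) is a polynomial in t with linear coefficient tr T; applying `divX` twice extracts
the remainder of order t². -/
theorem fderiv_clm_det_id (T : E →L[ℝ] E) :
    fderiv ℝ (fun A : E →L[ℝ] E => A.det) (ContinuousLinearMap.id ℝ E) T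
      = LinearMap.trace ℝ E T.toLinearMap := by
  let b := Module.finBasis ℝ E
  set M := LinearMap.toMatrix b b T.toLinearMap with hM
  obtain ⟨Q, hQ⟩ : ∃ Q : Polynomial ℝ, ∀ t : ℝ,
      (ContinuousLinearMap.id ℝ E + t • T).det = 1 + M.trace * t + Q.eval t * t ^ 2 := by
    refine ⟨(Matrix.det (1 + (Polynomial.X : Polynomial ℝ) • M.map Polynomial.C)).divX.divX,
      fun t => ?_⟩
    rw [← Matrix.det_one_add_smul, ContinuousLinearMap.det, ← LinearMap.det_toMatrix b]
    have h2 : ((ContinuousLinearMap.id ℝ E + t • T : E →L[ℝ] E) : E →ₗ[ℝ] E)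
      = LinearMap.id + t • T.toLinearMap := rfl
    rw [h2, map_add, map_smul, LinearMap.toMatrix_id b]
  have h1 : HasDerivAt (fun t : ℝ => (ContinuousLinearMap.id ℝ E + t • T).det) M.trace 0 := by
    have h := ((((hasDerivAt_id (0 : ℝ)).const_mul M.trace).const_add 1).add
      ((Q.hasDerivAt 0).mul ((hasDerivAt_id (0 : ℝ)).pow 2)))
    simp only [hQ]
    convert! h using 1
    simp
  have h2 : HasDerivAt (fun t : ℝ => (ContinuousLinearMap.id ℝ E + t • T).det)
      (fderiv ℝ (fun A : E →L[ℝ] E => A.det) (ContinuousLinearMap.id ℝ E) T) 0 := by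
    have hd : HasFDerivAt (fun A : E →L[ℝ] E => A.det)
        (fderiv ℝ (fun A : E →L[ℝ] E => A.det) (ContinuousLinearMap.id ℝ E))
        (ContinuousLinearMap.id ℝ E + (0 : ℝ) • T) := by
      rw [zero_smul, add_zero]
      exact ((contDiff_clm_det (n := 1)).differentiable one_ne_zero _).hasFDerivAt
    have hl : HasDerivAt (fun t : ℝ => ContinuousLinearMap.id ℝ E + t • T) T 0 := by
      simpa using ((hasDerivAt_id (0 : ℝ)).smul_const T).const_add (ContinuousLinearMap.id ℝ E)
    exact hd.comp_hasDerivAt 0 hl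
  rw [h2.unique h1, hM, LinearMap.trace_eq_matrix_trace ℝ b]

end Determinant

/-! ### Families of maps close to the identity -/

section NearIdentityFlow

variable {E F : Type*} [NormedAddCommGroup E] [NormedSpace ℝ E]
  [NormedAddCommGroup F] [NormedSpace ℝ F]

/-- The derivative of `Ψ : E × F → E` in its first variable. -/
noncomputable def fderivFst (Ψ : E × F → E) (z : E × F) : E →L[ℝ] E :=
  (fderiv ℝ Ψ z).comp (ContinuousLinearMap.inl ℝ E F)

theorem hasFDerivAt_fderivFst {Ψ : E × F → E} (hΨ : Differentiable ℝ Ψ) (x : E) (σ : F) :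
    HasFDerivAt (fun y => Ψ (y, σ)) (fderivFst Ψ (x, σ)) x :=
  (hΨ (x, σ)).hasFDerivAt.comp x (hasFDerivAt_prodMk_left x σ)

theorem contDiff_fderivFst {Ψ : E × F → E} (hΨ : ContDiff ℝ 2 Ψ) : ContDiff ℝ 1 (fderivFst Ψ) :=
  (hΨ.fderiv_right (m := 1) (by norm_num)).clm_comp contDiff_const

theorem fderivFst_eq_id {Ψ : E × F → E} (hΨ : Differentiable ℝ Ψ) {U : Set E} {x : E}
    (hU : U ∈ 𝓝 x) (h0 : ∀ y ∈ U, Ψ (y, 0) = y) :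
    fderivFst Ψ (x, 0) = ContinuousLinearMap.id ℝ E := by
  refine (hasFDerivAt_fderivFst hΨ x 0).unique ((hasFDerivAt_id x).congr_of_eventuallyEq ?_)
  filter_upwards [hU] with y hy using h0 y hy

variable [FiniteDimensional ℝ E]

/-- D_xΨ stays within 1/4 of the identity near (x₀, 0), so each Ψ(·, σ) is a Lipschitz perturbation
of the identity. The ball of radius R / 4 does not depend on σ, so the same test functions serve all
small σ. -/
theorem exists_ball_injOn_subset_image {Ψ : E × F → E} (hΨ : ContDiff ℝ 2 Ψ) {U : Set E} {x₀ : E}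
    (hU : U ∈ 𝓝 x₀) (h0 : ∀ y ∈ U, Ψ (y, 0) = y) :
    ∃ R > 0, ∃ δ > 0, Metric.closedBall x₀ R ⊆ U ∧ ∀ σ ∈ Metric.ball (0 : F) δ,
      Set.InjOn (fun x => Ψ (x, σ)) (Metric.closedBall x₀ R) ∧
      Metric.ball x₀ (R / 4) ⊆ (fun x => Ψ (x, σ)) '' (Metric.closedBall x₀ R) ∧
      ∀ x ∈ Metric.closedBall x₀ R, 0 < (fderivFst Ψ (x, σ)).det := by
  have hd := hΨ.differentiable two_ne_zero
  have hM := contDiff_fderivFst hΨ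
  have hid := fderivFst_eq_id hd hU h0
  have e1 : ∀ᶠ z in 𝓝 (x₀, (0 : F)), ‖fderivFst Ψ z - ContinuousLinearMap.id ℝ E‖ < 1 / 4 := by
    have : ContinuousAt (fun z => ‖fderivFst Ψ z - ContinuousLinearMap.id ℝ E‖) (x₀, (0 : F)) :=
      (hM.continuous.sub continuous_const).norm.continuousAt
    refine this.eventually (gt_mem_nhds ?_)
    simp [hid]
  have e2 : ∀ᶠ z in 𝓝 (x₀, (0 : F)), 0 < (fderivFst Ψ z).det := by
    have : ContinuousAt (fun z => (fderivFst Ψ z).det) (x₀, (0 : F)) :=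
      ((contDiff_clm_det (n := 1)).continuous.comp hM.continuous).continuousAt
    refine this.eventually (lt_mem_nhds ?_)
    simp [hid, ContinuousLinearMap.det]
  obtain ⟨ρ, hρ, hball⟩ := Metric.mem_nhds_iff.1 (e1.and e2)
  obtain ⟨r, hr, hrU⟩ := Metric.mem_nhds_iff.1 hU
  set R := min ρ r / 2 with hR
  have hRpos : 0 < R := by positivity
  have hRρ : R < ρ := by have := min_le_left ρ r; linarith [lt_min hρ hr]
  have hRr : R < r := by have := min_le_right ρ r; linarith [lt_min hρ hr]
  have e3 : ∀ᶠ σ in 𝓝 (0 : F), ‖Ψ (x₀, σ) - x₀‖ < R / 8 := by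
    have : ContinuousAt (fun σ : F => ‖Ψ (x₀, σ) - x₀‖) 0 :=
      ((hΨ.continuous.comp (continuous_const.prodMk continuous_id)).sub
        continuous_const).norm.continuousAt
    refine this.eventually (gt_mem_nhds ?_)
    simp only [h0 x₀ (mem_of_mem_nhds hU), sub_self, norm_zero]
    positivity
  obtain ⟨δ, hδ, hδball⟩ := Metric.mem_nhds_iff.1 e3
  refine ⟨R, hRpos, min δ ρ, lt_min hδ hρ, (Metric.closedBall_subset_ball hRr).trans hrU, ?_⟩
  intro σ hσ
  have hmem : ∀ x ∈ Metric.closedBall x₀ R, (x, σ) ∈ Metric.ball (x₀, (0 : F)) ρ := by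
    intro x hx
    rw [← ball_prod_same]
    exact ⟨Metric.closedBall_subset_ball hRρ hx, Metric.ball_subset_ball (min_le_right _ _) hσ⟩
  have hap : ApproximatesLinearOn (fun x => Ψ (x, σ))
      ((ContinuousLinearEquiv.refl ℝ E : E ≃L[ℝ] E) : E →L[ℝ] E)
      (Metric.closedBall x₀ R) (1 / 4 : NNReal) := by
    intro x hx y hy
    have := (convex_closedBall x₀ R).norm_image_sub_le_of_norm_hasFDerivWithin_le'
      (φ := ContinuousLinearMap.id ℝ E) (C := 1 / 4)
      (fun z hz => (hasFDerivAt_fderivFst hd z σ).hasFDerivWithinAt)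
      (fun z hz => (hball (hmem z hz)).1.le) hy hx
    simpa using this
  refine ⟨?_, ?_, fun x hx => (hball (hmem x hx)).2⟩
  · intro x hx y hy hxy
    have h1 := hap x hx y hy
    simp only [hxy, sub_self, zero_sub, norm_neg] at h1
    have h2 : ‖x - y‖ ≤ 1 / 4 * ‖x - y‖ := by simpa using h1
    have h3 : ‖x - y‖ = 0 := le_antisymm (by linarith) (norm_nonneg _)
    exact sub_eq_zero.1 (norm_eq_zero.1 h3)
  -- The image contains the ball of radius (1 - 1/4) R about Ψ(x₀, σ). Its centre is within R / 8 of
  -- x₀, and R / 4 + R / 8 ≤ 3R / 4.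
  · have hs := hap.surjOn_closedBall_of_nonlinearRightInverse
      ⟨fun y => y, 1, fun y => by simp, fun y => by simp⟩ hRpos.le subset_rfl
    intro y hy
    refine hs ?_
    have h8 : ‖Ψ (x₀, σ) - x₀‖ < R / 8 := hδball (Metric.ball_subset_ball (min_le_left _ _) hσ)
    rw [Metric.mem_closedBall]
    have h9 : dist y (Ψ (x₀, σ)) ≤ R / 4 + R / 8 :=
      (dist_triangle_right y _ x₀).trans
        (add_le_add (Metric.mem_ball.1 hy).le (by rw [dist_eq_norm]; exact h8.le))
    refine h9.trans ?_
    norm_num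
    linarith

/-- With X = ∂_σΨ(·, 0)e, the product rule at σ = 0 gives dχ(X) + χ tr(DX), the divergence of χX.
The trace comes from the derivative of the determinant at the identity, and ∂_σ commutes with D_x by
symmetry of the second derivative of Ψ. -/
theorem fderiv_comp_mul_det {Ψ : E × F → E} (hΨ : ContDiff ℝ 2 Ψ) {U : Set E} {x : E}
    (hU : U ∈ 𝓝 x) (h0 : ∀ y ∈ U, Ψ (y, 0) = y) {χ : E → ℝ} (hχ : ContDiff ℝ 1 χ) (e : F) :
    fderiv ℝ (fun z : E × F => χ (Ψ z) * (fderivFst Ψ z).det) (x, 0) (0, e)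
      = LinearMap.trace ℝ E
        (fderiv ℝ (fun y => χ y • fderiv ℝ Ψ (y, 0) (0, e)) x).toLinearMap := by
  have hd := hΨ.differentiable two_ne_zero
  have hM := (contDiff_fderivFst hΨ).differentiable one_ne_zero
  have hid := fderivFst_eq_id hd hU h0
  have hx0 : Ψ (x, 0) = x := h0 x (mem_of_mem_nhds hU)
  have hχd := hχ.differentiable one_ne_zero
  have hdd : Differentiable ℝ (fderiv ℝ Ψ) :=
    (hΨ.fderiv_right (m := 1) (by norm_num)).differentiable one_ne_zero
  have hdet := (contDiff_clm_det (E := E) (n := 1)).differentiable one_ne_zero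
  have h1 : HasFDerivAt (fun z : E × F => χ (Ψ z)) ((fderiv ℝ χ x).comp (fderiv ℝ Ψ (x, 0)))
      (x, 0) := by
    refine HasFDerivAt.comp (x, (0 : F)) ?_ (hd _).hasFDerivAt
    rw [hx0]
    exact (hχd x).hasFDerivAt
  have h2 : HasFDerivAt (fun z : E × F => (fderivFst Ψ z).det)
      ((fderiv ℝ (fun A : E →L[ℝ] E => A.det) (ContinuousLinearMap.id ℝ E)).comp
        (fderiv ℝ (fderivFst Ψ) (x, 0))) (x, 0) := by
    refine HasFDerivAt.comp (x, (0 : F)) (g := fun A : E →L[ℝ] E => A.det) ?_ (hM _).hasFDerivAt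
    rw [hid]
    exact (hdet _).hasFDerivAt
  rw [(h1.fun_mul h2).fderiv]
  have hX : HasFDerivAt (fun y : E => fderiv ℝ Ψ (y, 0) (0, e))
      (((fderiv ℝ (fderiv ℝ Ψ) (x, 0)).comp (ContinuousLinearMap.inl ℝ E F)).flip (0, e)) x := by
    have h3 : HasFDerivAt (fun y : E => fderiv ℝ Ψ (y, (0 : F)))
      ((fderiv ℝ (fderiv ℝ Ψ) (x, 0)).comp (ContinuousLinearMap.inl ℝ E F)) x :=
      (hdd (x, 0)).hasFDerivAt.comp x (hasFDerivAt_prodMk_left x (0 : F))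
    convert! h3.clm_apply (hasFDerivAt_const ((0 : E), e) x) using 1
    ext w
    simp
  rw [((hχd x).hasFDerivAt.fun_smul hX).fderiv]
  have hMd : fderiv ℝ (fderivFst Ψ) (x, 0) (0, e)
      = ((fderiv ℝ (fderiv ℝ Ψ) (x, 0)).comp (ContinuousLinearMap.inl ℝ E F)).flip (0, e) := by
    have h4 : HasFDerivAt (fderivFst Ψ)
      (((ContinuousLinearMap.compL ℝ E (E × F) E).flip (ContinuousLinearMap.inl ℝ E F)).comp
        (fderiv ℝ (fderiv ℝ Ψ) (x, 0))) (x, 0) :=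
      ((ContinuousLinearMap.compL ℝ E (E × F) E).flip
        (ContinuousLinearMap.inl ℝ E F)).hasFDerivAt.comp (x, (0 : F)) (hdd _).hasFDerivAt
    rw [h4.fderiv]
    ext w
    have := (hΨ.contDiffAt (x := (x, (0 : F)))).isSymmSndFDerivAt (by simp)
    simpa using this.eq (0, e) (w, 0)
  simp only [add_apply, smul_apply,
    ContinuousLinearMap.comp_apply, hMd, fderiv_clm_det_id, hx0, hid, smul_eq_mul]
  have htr : ((ContinuousLinearMap.smulRight (fderiv ℝ χ x) (fderiv ℝ Ψ (x, 0) (0, e))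
      : E →L[ℝ] E) : E →ₗ[ℝ] E)
      = (fderiv ℝ χ x).toLinearMap.smulRight (fderiv ℝ Ψ (x, 0) (0, e)) := rfl
  simp only [ContinuousLinearMap.toLinearMap_add, ContinuousLinearMap.toLinearMap_smul, map_add,
    map_smul, htr, LinearMap.trace_smulRight, smul_eq_mul]
  simp [ContinuousLinearMap.det]

variable [MeasurableSpace E] [BorelSpace E] (μ : Measure E) [μ.IsAddHaarMeasure]

/-- The change of variables formula makes the integral of the positive function det f' over this set
equal to the measure of a subset of N. It ensures that altering a function on a null set does not
affect its composition with Ψ(·, σ). -/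
theorem measure_inter_preimage_eq_zero {f : E → E} {f' : E → E →L[ℝ] E} {s N : Set E}
    (hs : MeasurableSet s) (hf' : ∀ x ∈ s, HasFDerivAt f (f' x) x) (hf : Continuous f)
    (hinj : Set.InjOn f s) (hdet : ∀ x ∈ s, 0 < (f' x).det) (hf'c : Continuous f')
    (hN : MeasurableSet N) (hN0 : μ N = 0) : μ (s ∩ f ⁻¹' N) = 0 := by
  have hm : MeasurableSet (s ∩ f ⁻¹' N) := hs.inter (hf.measurable hN)
  have h := lintegral_abs_det_fderiv_eq_addHaar_image μ hm
    (fun x hx => (hf' x hx.1).hasFDerivWithinAt) (hinj.mono Set.inter_subset_left)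
  have h0 : μ (f '' (s ∩ f ⁻¹' N)) = 0 := by
    refine measure_mono_null ?_ hN0
    rintro _ ⟨x, hx, rfl⟩
    exact hx.2
  rw [h0] at h
  have hmeas : Measurable fun x => ENNReal.ofReal |(f' x).det| :=
    (((contDiff_clm_det (n := 1)).continuous.comp hf'c).abs.measurable).ennreal_ofReal
  rw [setLIntegral_eq_zero_iff hm hmeas] at h
  rw [measure_eq_zero_iff_ae_notMem]
  filter_upwards [h] with x hx hxs
  have := hx hxs
  rw [ENNReal.ofReal_eq_zero] at this
  have h5 := hdet x hxs.1
  have h6 := le_abs_self (f' x).det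
  linarith

end NearIdentityFlow

/-! ### Weak form of invariance under a family of maps -/

section InvariantFunction

variable {E F : Type*} [NormedAddCommGroup E] [NormedSpace ℝ E]
  [NormedAddCommGroup F] [NormedSpace ℝ F] [FiniteDimensional ℝ F]
  [MeasurableSpace E] [BorelSpace E] (μ : Measure E)

theorem hasFDerivAt_setIntegral_mul {k : E × F → ℝ} (hk : ContDiff ℝ 1 k) {G : E → ℝ} {B : Set E}
    (hB : IsCompact B) (hG : IntegrableOn G B μ) (σ₀ : F) :
    HasFDerivAt (fun σ => ∫ x in B, G x * k (x, σ) ∂μ)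
      (∫ x in B, G x • (fderiv ℝ k (x, σ₀)).comp (ContinuousLinearMap.inr ℝ E F) ∂μ) σ₀ := by
  have hkd := hk.differentiable one_ne_zero
  have hkc : Continuous (fderiv ℝ k) := hk.continuous_fderiv one_ne_zero
  have hc : Continuous fun z : E × F => (fderiv ℝ k z).comp (ContinuousLinearMap.inr ℝ E F) :=
    hkc.clm_comp continuous_const
  obtain ⟨C, hC⟩ := (hB.prod (isCompact_closedBall σ₀ (1 : ℝ))).exists_bound_of_continuousOn
    hc.continuousOn
  have hsl : ∀ σ : F, Continuous fun x : E => (x, σ) := fun σ => by fun_prop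
  refine hasFDerivAt_integral_of_dominated_of_fderiv_le (s := Metric.closedBall σ₀ 1)
    (F' := fun σ x => G x • (fderiv ℝ k (x, σ)).comp (ContinuousLinearMap.inr ℝ E F))
    (bound := fun x => ‖G x‖ * C) (Metric.closedBall_mem_nhds σ₀ one_pos) ?_ ?_ ?_ ?_ ?_ ?_
  · exact .of_forall fun σ =>
      hG.aestronglyMeasurable.mul (hk.continuous.comp (hsl σ)).aestronglyMeasurable
  · exact hG.mul_continuousOn (hk.continuous.comp (hsl σ₀)).continuousOn hB
  · exact hG.aestronglyMeasurable.smul (hc.comp (hsl σ₀)).aestronglyMeasurable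
  · refine (ae_restrict_mem hB.measurableSet).mono fun x hx σ hσ => ?_
    rw [norm_smul]
    exact mul_le_mul_of_nonneg_left (hC (x, σ) ⟨hx, hσ⟩) (norm_nonneg _)
  · exact hG.norm.mul_const C
  · refine .of_forall fun x σ _ => ?_
    have h := ((hkd (x, σ)).hasFDerivAt.comp σ (hasFDerivAt_prodMk_right x σ)).const_mul (G x)
    exact h

variable [FiniteDimensional ℝ E] [μ.IsAddHaarMeasure]

theorem setIntegral_comp_mul_det {f : E → E} {f' : E → E →L[ℝ] E} {B : Set E}
    (hB : MeasurableSet B) (hf' : ∀ x ∈ B, HasFDerivAt f (f' x) x) (hinj : Set.InjOn f B)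
    (hdet : ∀ x ∈ B, 0 < (f' x).det) {χ G : E → ℝ} (hχ : Function.support χ ⊆ f '' B)
    (hG : ∀ᵐ x ∂μ, x ∈ B → G x = G (f x)) :
    ∫ x in B, G x * (χ (f x) * (f' x).det) ∂μ = ∫ x, G x * χ x ∂μ := by
  have h1 := integral_image_eq_integral_abs_det_fderiv_smul μ hB
    (fun x hx => (hf' x hx).hasFDerivWithinAt) hinj (fun x => G x * χ x)
  rw [setIntegral_eq_integral_of_forall_compl_eq_zero] at h1
  · rw [h1]
    refine setIntegral_congr_ae hB (hG.mono fun x hx hxB => ?_)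
    rw [abs_of_pos (hdet x hxB), hx hxB, smul_eq_mul]
    ring
  · intro x hx
    have : χ x = 0 := by
      by_contra h
      exact hx (hχ h)
    simp [this]

variable [MeasurableSpace F] [BorelSpace F] (ν : Measure F) [ν.IsAddHaarMeasure]

/-- Fubini exchanges the two quantifiers, but requires measurable sets. So G is replaced by a Borel
representative; the pairs for which Ψ(x, σ) falls in the exceptional set are negligible by `hnull`.
-/
theorem ae_ae_eq_comp_of_ae_ae_eq_comp {Ψ : E × F → E} (hΨ : Continuous Ψ) {G G' : E → ℝ}
    {B : Set E} {W : Set F} (hB : MeasurableSet B) (hW : MeasurableSet W)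
    (hnull : ∀ σ ∈ W, ∀ N, MeasurableSet N → μ N = 0 → μ (B ∩ (fun x => Ψ (x, σ)) ⁻¹' N) = 0)
    (hG' : Measurable G') (hGG' : G =ᵐ[μ] G')
    (h : ∀ᵐ x ∂μ, x ∈ B → ∀ᵐ σ ∂ν, σ ∈ W → G x = G (Ψ (x, σ))) :
    ∀ᵐ σ ∂ν, σ ∈ W → ∀ᵐ x ∂μ, x ∈ B → G' x = G' (Ψ (x, σ)) := by
  set N := toMeasurable μ {x | G x ≠ G' x} with hN
  have hNm : MeasurableSet N := measurableSet_toMeasurable _ _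
  have hN0 : μ N = 0 := by rw [hN, measure_toMeasurable]; exact ae_iff.1 hGG'
  have hNG : ∀ x, x ∉ N → G x = G' x := fun x hx => by
    by_contra hne
    exact hx (subset_toMeasurable μ _ hne)
  have hbad : ∀ᵐ x ∂μ, ∀ᵐ σ ∂ν, x ∈ B → σ ∈ W → Ψ (x, σ) ∉ N := by
    refine (Measure.ae_ae_comm (μ := μ) (ν := ν)
      (p := fun x σ => x ∈ B → σ ∈ W → Ψ (x, σ) ∉ N) ?_).2 ?_
    · have e : {z : E × F | z.1 ∈ B → z.2 ∈ W → Ψ (z.1, z.2) ∉ N}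
        = ((Prod.fst ⁻¹' B) ∩ (Prod.snd ⁻¹' W) ∩ (Ψ ⁻¹' N))ᶜ := by
        ext z
        simp
      rw [e]
      exact (((measurable_fst hB).inter (measurable_snd hW)).inter (hΨ.measurable hNm)).compl
    · refine .of_forall fun σ => ?_
      by_cases hσ : σ ∈ W
      · have := measure_eq_zero_iff_ae_notMem.1 (hnull σ hσ N hNm hN0)
        filter_upwards [this] with x hx hxB _ hxN
        exact hx ⟨hxB, hxN⟩
      · exact .of_forall fun x _ h => absurd h hσ
  have key : ∀ᵐ x ∂μ, ∀ᵐ σ ∂ν, x ∈ B → σ ∈ W → G' x = G' (Ψ (x, σ)) := by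
    filter_upwards [h, hbad, hGG'] with x hx hxb hxG
    by_cases hxB : x ∈ B
    · filter_upwards [hx hxB, hxb] with σ h1 h2 _ hσ
      rw [← hxG, h1 hσ, hNG _ (h2 hxB hσ)]
    · exact .of_forall fun σ h => absurd h hxB
  have := (Measure.ae_ae_comm (μ := μ) (ν := ν)
      (p := fun x σ => x ∈ B → σ ∈ W → G' x = G' (Ψ (x, σ))) ?_).1 key
  · filter_upwards [this] with σ hσ hσW
    filter_upwards [hσ] with x hx hxB using hx hxB hσW
  · have e : {z : E × F | z.1 ∈ B → z.2 ∈ W → G' z.1 = G' (Ψ (z.1, z.2))}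
        = (Prod.fst ⁻¹' B)ᶜ ∪ (Prod.snd ⁻¹' W)ᶜ ∪ {z | G' z.1 = G' (Ψ z)} := by
      ext z
      simp only [Set.mem_ofPred_eq, Set.mem_union, Set.mem_compl_iff, Set.mem_preimage]
      tauto
    rw [e]
    exact ((measurable_fst hB).compl.union (measurable_snd hW).compl).union
      (measurableSet_eq_fun (hG'.comp measurable_fst) (hG'.comp hΨ.measurable))

/-- If `G` is almost everywhere invariant under a `C²` family `Ψ(·, σ)` of maps with
`Ψ(·, 0) = id`, then `G` is annihilated, in the sense of distributions, by the vector fields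
`∂_σ Ψ(·, 0) e`. -/
theorem integral_mul_trace_fderiv_eq_zero {Ψ : E × F → E} (hΨ : ContDiff ℝ 2 Ψ) {U : Set E}
    {V : Set F} {x₀ : E} (hU : U ∈ 𝓝 x₀) (hV : V ∈ 𝓝 (0 : F)) (h0 : ∀ y ∈ U, Ψ (y, 0) = y)
    {G : E → ℝ} (hG : LocallyIntegrable G μ)
    (h : ∀ᵐ x ∂μ, x ∈ U → ∀ᵐ σ ∂ν, σ ∈ V → G x = G (Ψ (x, σ))) :
    ∃ r > 0, ∀ χ : E → ℝ, ContDiff ℝ 1 χ → tsupport χ ⊆ Metric.ball x₀ r → ∀ e : F,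
      ∫ x, G x * LinearMap.trace ℝ E
        (fderiv ℝ (fun y => χ y • fderiv ℝ Ψ (y, 0) (0, e)) x).toLinearMap ∂μ = 0 := by
  obtain ⟨R, hR, δ₀, hδ₀, hBU', hflow⟩ := exists_ball_injOn_subset_image hΨ
    (interior_mem_nhds.2 hU) (fun y hy => h0 y (interior_subset hy))
  have hBU := hBU'.trans interior_subset
  obtain ⟨δ₁, hδ₁, hδV⟩ := Metric.mem_nhds_iff.1 hV
  set δ := min δ₀ δ₁
  have hδ : 0 < δ := lt_min hδ₀ hδ₁
  set B := Metric.closedBall x₀ R with hBdef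
  have hBc : IsCompact B := isCompact_closedBall x₀ R
  have hΨd := hΨ.differentiable two_ne_zero
  obtain ⟨G', hG'm, hGG'⟩ : ∃ G' : E → ℝ, Measurable G' ∧ G =ᵐ[μ] G' :=
    ⟨_, hG.aestronglyMeasurable.stronglyMeasurable_mk.measurable,
      hG.aestronglyMeasurable.ae_eq_mk⟩
  have hinv := ae_ae_eq_comp_of_ae_ae_eq_comp μ ν hΨ.continuous hBc.measurableSet
    (Metric.isOpen_ball (x := (0 : F)) (ε := δ)).measurableSet
    (fun σ hσ N hN hN0 => by
      obtain ⟨hinj, -, hdet⟩ := hflow σ (Metric.ball_subset_ball (min_le_left _ _) hσ)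
      exact measure_inter_preimage_eq_zero μ hBc.measurableSet
        (fun x _ => hasFDerivAt_fderivFst hΨd x σ)
        (hΨ.continuous.comp (by fun_prop)) hinj hdet
        ((contDiff_fderivFst hΨ).continuous.comp (by fun_prop)) hN hN0)
    hG'm hGG' (by
      filter_upwards [h] with x hx hxB
      filter_upwards [hx (hBU hxB)] with σ hσ hσδ
      exact hσ (hδV (Metric.ball_subset_ball (min_le_right _ _) hσδ)))
  refine ⟨R / 4, by positivity, fun χ hχ hsupp e => ?_⟩
  set k : E × F → ℝ := fun z => χ (Ψ z) * (fderivFst Ψ z).det with hkdef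
  have hk : ContDiff ℝ 1 k := (hχ.comp (hΨ.of_le (by norm_num))).mul
    (contDiff_clm_det.comp (contDiff_fderivFst hΨ))
  have hG'B : IntegrableOn G' B μ :=
    (hG.integrableOn_isCompact hBc).congr (ae_restrict_of_ae hGG')
  have hJ := hasFDerivAt_setIntegral_mul μ hk hBc hG'B
  -- By change of variables and invariance, J(σ) = ∫ G'χ for almost every small σ. Since J is
  -- continuous it is constant near 0, so its derivative at 0, the integral sought, vanishes.
  set J : F → ℝ := fun σ => ∫ x in B, G' x * k (x, σ) ∂μ with hJdef
  have hJc : Continuous J := continuous_iff_continuousAt.2 fun σ => (hJ σ).continuousAt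
  have hae : ∀ᵐ σ ∂(ν.restrict (Metric.ball 0 δ)), J σ = ∫ x, G' x * χ x ∂μ := by
    refine (ae_restrict_iff' Metric.isOpen_ball.measurableSet).2 ?_
    filter_upwards [hinv] with σ hσ hσδ
    obtain ⟨hinj, himg, hdet⟩ := hflow σ (Metric.ball_subset_ball (min_le_left _ _) hσδ)
    exact setIntegral_comp_mul_det μ hBc.measurableSet
      (fun x _ => hasFDerivAt_fderivFst hΨd x σ) hinj hdet
      ((subset_tsupport χ).trans (hsupp.trans himg)) (hσ hσδ)
  have heq := Measure.eqOn_open_of_ae_eq hae Metric.isOpen_ball hJc.continuousOn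
    continuousOn_const
  have hJ0 : HasFDerivAt J (0 : F →L[ℝ] ℝ) 0 := by
    refine (hasFDerivAt_const (∫ x, G' x * χ x ∂μ) (0 : F)).congr_of_eventuallyEq ?_
    filter_upwards [Metric.ball_mem_nhds (0 : F) hδ] with σ hσ using heq hσ
  have hzero := congrArg (fun L : F →L[ℝ] ℝ => L e) ((hJ 0).unique hJ0)
  simp only [zero_apply] at hzero
  have hcont : Continuous fun x : E =>
      (fderiv ℝ k (x, 0)).comp (ContinuousLinearMap.inr ℝ E F) :=
    ((hk.continuous_fderiv one_ne_zero).comp (by fun_prop)).clm_comp continuous_const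
  rw [ContinuousLinearMap.integral_apply] at hzero
  swap
  · exact hG'B.smul_continuousOn hcont.continuousOn hBc
  have hBint : Metric.ball x₀ (R / 4) ⊆ B :=
    (Metric.ball_subset_ball (by linarith)).trans Metric.ball_subset_closedBall
  rw [← setIntegral_eq_integral_of_forall_compl_eq_zero (s := B), ← hzero]
  · refine setIntegral_congr_ae hBc.measurableSet ?_
    filter_upwards [hGG'] with x hx hxB
    rw [hx, ← fderiv_comp_mul_det hΨ (mem_interior_iff_mem_nhds.1 (hBU' hxB)) h0 hχ e]
    simp [hkdef]
  · intro x hx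
    have hx' : x ∉ tsupport χ := fun h => hx (hBint (hsupp h))
    have : (fun y => χ y • fderiv ℝ Ψ (y, 0) (0, e)) =ᶠ[𝓝 x] fun _ => 0 := by
      filter_upwards [notMem_tsupport_iff_eventuallyEq.1 hx'] with y hy
      simp [hy]
    rw [this.fderiv_eq]
    simp


/-- Coordinates of W in a basis of F split the field into pieces with a scalar test function and a
fixed direction. -/
theorem integral_mul_trace_fderiv_eq_zero_of_vectorField {Ψ : E × F → E} (hΨ : ContDiff ℝ 2 Ψ)
    {U : Set E} {V : Set F} {x₀ : E} (hU : U ∈ 𝓝 x₀) (hV : V ∈ 𝓝 (0 : F))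
    (h0 : ∀ y ∈ U, Ψ (y, 0) = y) {G : E → ℝ} (hG : LocallyIntegrable G μ)
    (h : ∀ᵐ x ∂μ, x ∈ U → ∀ᵐ σ ∂ν, σ ∈ V → G x = G (Ψ (x, σ))) :
    ∃ r > 0, ∀ W : E → F, ContDiff ℝ 1 W → tsupport W ⊆ Metric.ball x₀ r →
      ∫ x, G x * LinearMap.trace ℝ E
        (fderiv ℝ (fun y => fderiv ℝ Ψ (y, 0) (0, W y)) x).toLinearMap ∂μ = 0 := by
  obtain ⟨r, hr, hχ⟩ := integral_mul_trace_fderiv_eq_zero μ ν hΨ hU hV h0 hG h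
  refine ⟨r, hr, fun W hW hsupp => ?_⟩
  let b := Module.finBasis ℝ F
  set χ : Fin (Module.finrank ℝ F) → E → ℝ := fun k y => b.coord k (W y) with hχdef
  have hχC : ∀ k, ContDiff ℝ 1 (χ k) := fun k =>
    (b.coord k).toContinuousLinearMap.contDiff.comp hW
  have hχt : ∀ k, tsupport (χ k) ⊆ tsupport W := fun k => by
    refine closure_mono fun y hy => ?_
    contrapose hy
    simp [χ, Function.notMem_support.1 hy]
  have hX : ∀ e : F, ContDiff ℝ 1 fun y : E => fderiv ℝ Ψ (y, 0) ((0 : E), e) := fun e =>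
    ((hΨ.fderiv_right (m := 1) (by norm_num)).comp (by fun_prop)).clm_apply contDiff_const
  have hχX : ∀ k, ContDiff ℝ 1 fun y => χ k y • fderiv ℝ Ψ (y, 0) ((0 : E), b k) := fun k =>
    (hχC k).smul (hX _)
  have hsum : (fun y => fderiv ℝ Ψ (y, 0) ((0 : E), W y))
      = fun y => ∑ k, χ k y • fderiv ℝ Ψ (y, 0) ((0 : E), b k) := by
    funext y
    have h1 : ((0 : E), W y) = ∑ k, χ k y • ((0 : E), b k) := by
      refine Prod.ext ?_ ?_
      · simp [Prod.fst_sum]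
      · simp [Prod.snd_sum, χ]
    rw [h1, map_sum]
    simp only [map_smul]
  have htr : ∀ x, LinearMap.trace ℝ E
      (fderiv ℝ (fun y => fderiv ℝ Ψ (y, 0) (0, W y)) x).toLinearMap = ∑ k, LinearMap.trace ℝ E
        (fderiv ℝ (fun y => χ k y • fderiv ℝ Ψ (y, 0) (0, b k)) x).toLinearMap := by
    intro x
    rw [hsum, fderiv_fun_sum fun k _ => (hχX k).differentiable one_ne_zero x,
      ContinuousLinearMap.toLinearMap_sum, map_sum]
  simp only [htr, Finset.mul_sum]
  rw [integral_finsetSum]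
  · exact Finset.sum_eq_zero fun k _ => hχ (χ k) (hχC k) ((hχt k).trans hsupp) (b k)
  · intro k _
    have hc : Continuous fun x => LinearMap.trace ℝ E
        (fderiv ℝ (fun y => χ k y • fderiv ℝ Ψ (y, 0) (0, b k)) x).toLinearMap :=
      ((LinearMap.trace ℝ E).comp (ContinuousLinearMap.coeLM ℝ)).continuous_of_finiteDimensional.comp
        ((hχX k).continuous_fderiv one_ne_zero)
    have hcs : HasCompactSupport fun x => LinearMap.trace ℝ E
        (fderiv ℝ (fun y => χ k y • fderiv ℝ Ψ (y, 0) (0, b k)) x).toLinearMap := by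
      have hW : HasCompactSupport (χ k) := HasCompactSupport.of_support_subset_isCompact
        (isCompact_closedBall x₀ r)
        ((subset_tsupport _).trans ((hχt k).trans (hsupp.trans Metric.ball_subset_closedBall)))
      exact ((hW.smul_right (f' := fun y => fderiv ℝ Ψ (y, 0) ((0 : E), b k))).fderiv
        (𝕜 := ℝ)).comp_left (g := fun T : E →L[ℝ] E => LinearMap.trace ℝ E T.toLinearMap)
        (by simp)
    simpa [mul_comm] using hG.integrable_smul_left_of_hasCompactSupport hc hcs

end InvariantFunction

theorem contDiff_smul_of_contDiffAt {X Y : Type*} [NormedAddCommGroup X] [NormedSpace ℝ X]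
    [NormedAddCommGroup Y] [NormedSpace ℝ Y] {n : WithTop ℕ∞} {χ : X → ℝ} {f : X → Y}
    (hχ : ContDiff ℝ n χ) (hf : ∀ x ∈ tsupport χ, ContDiffAt ℝ n f x) :
    ContDiff ℝ n fun x => χ x • f x := by
  refine contDiff_iff_contDiffAt.2 fun x => ?_
  by_cases hx : x ∈ tsupport χ
  · exact hχ.contDiffAt.smul (hf x hx)
  · refine (contDiffAt_const (c := (0 : Y))).congr_of_eventuallyEq ?_
    filter_upwards [notMem_tsupport_iff_eventuallyEq.1 hx] with y hy
    simp [hy]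

theorem trace_fderiv_smul_const {X : Type*} [NormedAddCommGroup X] [NormedSpace ℝ X]
    [FiniteDimensional ℝ X] {f : X → ℝ} {x : X} (hf : DifferentiableAt ℝ f x) (e : X) :
    LinearMap.trace ℝ X (fderiv ℝ (fun y => f y • e) x).toLinearMap = fderiv ℝ f x e := by
  rw [fderiv_smul_const hf]
  exact LinearMap.trace_smulRight (fderiv ℝ f x).toLinearMap e

/-! ### The divergence-free tangent field -/

section CollisionForm

variable {d : ℕ}

/-- The difference `∂_a ω(v) - ∂_a ω(v_*)` of directional derivatives. -/
noncomputable def derivDiff (ω : Vel d → ℝ) (a : Vel d) (z : Vel d × Vel d) : ℝ :=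
  fderiv ℝ ω z.1 a - fderiv ℝ ω z.2 a

/-- The derivative of `χ` along the vector field
`∂_a(ω(v) - ω(v_*)) (b, -b) - ∂_b(ω(v) - ω(v_*)) (a, -a)`, which is tangent to the
collision manifolds. -/
noncomputable def collisionForm (ω : Vel d → ℝ) (a b : Vel d) (χ : Vel d × Vel d → ℝ)
    (z : Vel d × Vel d) : ℝ :=
  derivDiff ω a z * fderiv ℝ χ z (b, -b) - derivDiff ω b z * fderiv ℝ χ z (a, -a)

variable {ω : Vel d → ℝ}

theorem contDiffAt_two (hω : ContDiffOn ℝ 2 ω {v | v ≠ 0}) {v : Vel d} (hv : v ≠ 0) :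
    ContDiffAt ℝ 2 ω v :=
  hω.contDiffAt (isOpen_ne.mem_nhds hv)

theorem contDiffAt_fderiv (hω : ContDiffOn ℝ 2 ω {v | v ≠ 0}) {v : Vel d} (hv : v ≠ 0) :
    ContDiffAt ℝ 1 (fderiv ℝ ω) v :=
  (contDiffAt_two hω hv).fderiv_right (by norm_num)

theorem contDiffAt_derivDiff (hω : ContDiffOn ℝ 2 ω {v | v ≠ 0}) (a : Vel d)
    {z : Vel d × Vel d} (hz : z ∈ puncturedPairs d) : ContDiffAt ℝ 1 (derivDiff ω a) z :=
  (((contDiffAt_fderiv hω hz.1).comp z contDiffAt_fst).clm_apply contDiffAt_const).sub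
    (((contDiffAt_fderiv hω hz.2).comp z contDiffAt_snd).clm_apply contDiffAt_const)

theorem fderiv_derivDiff (hω : ContDiffOn ℝ 2 ω {v | v ≠ 0}) (a b : Vel d)
    {z : Vel d × Vel d} (hz : z ∈ puncturedPairs d) :
    fderiv ℝ (derivDiff ω a) z (b, -b)
      = fderiv ℝ (fderiv ℝ ω) z.1 b a + fderiv ℝ (fderiv ℝ ω) z.2 b a := by
  have h1 := ((contDiffAt_fderiv hω hz.1).differentiableAt one_ne_zero).hasFDerivAt.comp z
    hasFDerivAt_fst
  have h2 := ((contDiffAt_fderiv hω hz.2).differentiableAt one_ne_zero).hasFDerivAt.comp z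
    hasFDerivAt_snd
  have h := (h1.clm_apply (hasFDerivAt_const a z)).fun_sub
    (h2.clm_apply (hasFDerivAt_const a z))
  have e : HasFDerivAt (derivDiff ω a) _ z := h
  rw [e.fderiv]
  simp

/-- Both sides are D²ω(v)(a, b) + D²ω(v_*)(a, b). This is why the field in `collisionForm` has zero
divergence. -/
theorem fderiv_derivDiff_comm (hω : ContDiffOn ℝ 2 ω {v | v ≠ 0}) (a b : Vel d)
    {z : Vel d × Vel d} (hz : z ∈ puncturedPairs d) :
    fderiv ℝ (derivDiff ω a) z (b, -b) = fderiv ℝ (derivDiff ω b) z (a, -a) := by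
  rw [fderiv_derivDiff hω a b hz, fderiv_derivDiff hω b a hz,
    ((contDiffAt_two hω hz.1).isSymmSndFDerivAt (by simp)).eq a b,
    ((contDiffAt_two hω hz.2).isSymmSndFDerivAt (by simp)).eq a b]

theorem contDiff_mul_derivDiff (hω : ContDiffOn ℝ 2 ω {v | v ≠ 0}) (a : Vel d)
    {χ : Vel d × Vel d → ℝ} (hχ : ContDiff ℝ 1 χ) (hs : tsupport χ ⊆ puncturedPairs d) :
    ContDiff ℝ 1 fun z => χ z * derivDiff ω a z :=
  contDiff_smul_of_contDiffAt hχ fun _ hx => contDiffAt_derivDiff hω a (hs hx)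

theorem collisionForm_eq_sub (hω : ContDiffOn ℝ 2 ω {v | v ≠ 0}) (a b : Vel d)
    {χ : Vel d × Vel d → ℝ} (hχ : ContDiff ℝ 1 χ) (hs : tsupport χ ⊆ puncturedPairs d)
    (z : Vel d × Vel d) :
    collisionForm ω a b χ z = fderiv ℝ (fun y => χ y * derivDiff ω a y) z (b, -b)
      - fderiv ℝ (fun y => χ y * derivDiff ω b y) z (a, -a) := by
  have hχd := hχ.differentiable one_ne_zero z
  by_cases hz : z ∈ tsupport χ
  · have h := fun a => (contDiffAt_derivDiff hω a (hs hz)).differentiableAt one_ne_zero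
    rw [fderiv_fun_mul hχd (h a), fderiv_fun_mul hχd (h b)]
    simp only [add_apply, smul_apply, smul_eq_mul, collisionForm,
      fderiv_derivDiff_comm hω a b (hs hz)]
    ring
  · have h0 := notMem_tsupport_iff_eventuallyEq.1 hz
    have h1 : ∀ a, (fun y => χ y * derivDiff ω a y) =ᶠ[𝓝 z] fun _ => 0 := fun a => by
      filter_upwards [h0] with y hy
      simp [hy]
    rw [(h1 a).fderiv_eq, (h1 b).fderiv_eq, collisionForm, h0.fderiv_eq]
    simp

/-- For a divergence-free field Z, div(χZ) = Zχ. -/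
theorem trace_fderiv_smul_tangent (hω : ContDiffOn ℝ 2 ω {v | v ≠ 0}) (a b : Vel d)
    {χ : Vel d × Vel d → ℝ} (hχ : ContDiff ℝ 1 χ) (hs : tsupport χ ⊆ puncturedPairs d)
    (z : Vel d × Vel d) :
    LinearMap.trace ℝ (Vel d × Vel d) (fderiv ℝ (fun y => χ y •
      (derivDiff ω a y • (b, -b) - derivDiff ω b y • (a, -a))) z).toLinearMap
      = collisionForm ω a b χ z := by
  have h := fun a => (contDiff_mul_derivDiff hω a hχ hs).differentiable one_ne_zero z
  rw [collisionForm_eq_sub hω a b hχ hs, ← trace_fderiv_smul_const (h a),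
    ← trace_fderiv_smul_const (h b), ← map_sub, ← ContinuousLinearMap.toLinearMap_sub,
    ← fderiv_fun_sub ((h a).smul_const _) ((h b).smul_const _)]
  simp only [smul_sub, smul_smul]

end CollisionForm

/-! ### The infinitesimal identity near a point of the collision set -/

section LocalIdentity

variable {d : ℕ} {ω : Vel d → ℝ} {p : Vel d × Vel d} {U : Set (Vel d × Vel d)}
  {V : Set (Vel (d - 1))} {ψ : Vel d × Vel d × Vel (d - 1) → Vel d}

/-- The derivative `D_σ ψ(v, v_*, 0)`. -/
noncomputable def paramDeriv (ψ : Vel d × Vel d × Vel (d - 1) → Vel d) (z : Vel d × Vel d) :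
    Vel (d - 1) →L[ℝ] Vel d :=
  fderiv ℝ (fun σ : Vel (d - 1) => ψ (z.1, z.2, σ)) 0

theorem paramDeriv_eq (hψ : Differentiable ℝ ψ) (z : Vel d × Vel d) :
    paramDeriv ψ z = (fderiv ℝ ψ (z.1, z.2, 0)).comp
      ((ContinuousLinearMap.inr ℝ (Vel d) (Vel d × Vel (d - 1))).comp
        (ContinuousLinearMap.inr ℝ (Vel d) (Vel (d - 1)))) := by
  have h : HasFDerivAt (fun σ : Vel (d - 1) => (z.1, z.2, σ))
      ((ContinuousLinearMap.inr ℝ (Vel d) (Vel d × Vel (d - 1))).comp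
        (ContinuousLinearMap.inr ℝ (Vel d) (Vel (d - 1)))) 0 :=
    (hasFDerivAt_prodMk_right z.1 (z.2, (0 : Vel (d - 1)))).comp (0 : Vel (d - 1))
      (hasFDerivAt_prodMk_right z.2 (0 : Vel (d - 1)))
  exact ((hψ (z.1, z.2, 0)).hasFDerivAt.comp (0 : Vel (d - 1)) h).fderiv

theorem contDiff_paramDeriv (hψ : ContDiff ℝ 2 ψ) : ContDiff ℝ 1 (paramDeriv ψ) := by
  rw [funext (paramDeriv_eq (hψ.differentiable two_ne_zero))]
  exact ((hψ.fderiv_right (m := 1) (by norm_num)).comp (by fun_prop)).clm_comp contDiff_const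

theorem fderiv_ne_of_mem_collisionSet {z : Vel d × Vel d} (hz : z ∈ collisionSet ω) :
    fderiv ℝ ω z.1 ≠ fderiv ℝ ω z.2 := by
  intro h
  exact hz.2 (by simp only [gradient, h])

theorem IsCollisionParam.paramDeriv_injective (h : IsCollisionParam ω p U V ψ)
    {z : Vel d × Vel d} (hz : z ∈ U) : Function.Injective (paramDeriv ψ z) := by
  have hr : Module.finrank ℝ (LinearMap.range (paramDeriv ψ z).toLinearMap) = d - 1 := by
    have := h.rank_eq z.1 z.2 hz
    change Cardinal.toNat (paramDeriv ψ z).toLinearMap.rank = d - 1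
    rw [paramDeriv, this, Cardinal.toNat_natCast]
  have h2 := LinearMap.finrank_range_add_finrank_ker (paramDeriv ψ z).toLinearMap
  rw [hr, finrank_euclideanSpace_fin] at h2
  have h3 : LinearMap.ker (paramDeriv ψ z).toLinearMap = ⊥ :=
    Submodule.finrank_eq_zero.1 (by omega)
  exact LinearMap.ker_eq_bot.1 h3

theorem IsCollisionParam.fderiv_sub_comp_paramDeriv (h : IsCollisionParam ω p U V ψ)
    (hω : ContDiffOn ℝ 2 ω {v | v ≠ 0}) {z : Vel d × Vel d} (hz : z ∈ U) (e : Vel (d - 1)) :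
    (fderiv ℝ ω z.1 - fderiv ℝ ω z.2) (paramDeriv ψ z e) = 0 := by
  have hψd := h.contDiff.differentiable two_ne_zero
  have h0 : ψ (z.1, z.2, 0) = 0 := h.map_zero z.1 z.2 hz
  have hzp := (h.subset_U hz).1
  have hψ : HasFDerivAt (fun σ : Vel (d - 1) => ψ (z.1, z.2, σ)) (paramDeriv ψ z) 0 :=
    (hψd.comp (f := fun σ : Vel (d - 1) => (z.1, z.2, σ)) (by fun_prop) 0).hasFDerivAt
  have h1 : HasFDerivAt (fun σ : Vel (d - 1) => ω (z.1 - ψ (z.1, z.2, σ)))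
      ((fderiv ℝ ω z.1).comp (-paramDeriv ψ z)) 0 := by
    refine HasFDerivAt.comp (0 : Vel (d - 1)) (g := ω) ?_ (hψ.const_sub z.1)
    rw [h0, sub_zero]
    exact ((contDiffAt_two hω hzp.1).differentiableAt two_ne_zero).hasFDerivAt
  have h2 : HasFDerivAt (fun σ : Vel (d - 1) => ω (z.2 + ψ (z.1, z.2, σ)))
      ((fderiv ℝ ω z.2).comp (paramDeriv ψ z)) 0 := by
    refine HasFDerivAt.comp (0 : Vel (d - 1)) (g := ω) ?_ (hψ.const_add z.2)
    rw [h0, add_zero]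
    exact ((contDiffAt_two hω hzp.2).differentiableAt two_ne_zero).hasFDerivAt
  have h3 := (h1.add h2).unique ((hasFDerivAt_const (ω z.1 + ω z.2) _).congr_of_eventuallyEq (by
    filter_upwards [h.nhds_V] with σ hσ
    exact (h.conserve z.1 z.2 σ hz hσ).symm))
  have h4 := congrArg (fun L : Vel (d - 1) →L[ℝ] ℝ => L e) h3
  simp at h4
  simp
  linarith

/-- The range of D_σψ lies in the kernel of the nonzero functional ∇ω(v) - ∇ω(v_*), and both have
dimension d - 1. -/
theorem IsCollisionParam.exists_paramDeriv_eq (hd : 1 ≤ d) (h : IsCollisionParam ω p U V ψ)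
    (hω : ContDiffOn ℝ 2 ω {v | v ≠ 0}) {z : Vel d × Vel d} (hz : z ∈ U) {y : Vel d}
    (hy : (fderiv ℝ ω z.1 - fderiv ℝ ω z.2) y = 0) : ∃ e, paramDeriv ψ z e = y := by
  set L := fderiv ℝ ω z.1 - fderiv ℝ ω z.2 with hL
  have hL0 : L.toLinearMap ≠ 0 := by
    intro h0
    exact fderiv_ne_of_mem_collisionSet (h.subset_U hz)
      (sub_eq_zero.1 (ContinuousLinearMap.coe_injective h0))
  have hk := Module.Dual.finrank_ker_add_one_of_ne_zero (f := L.toLinearMap) hL0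
  have hle : LinearMap.range (paramDeriv ψ z).toLinearMap ≤ LinearMap.ker L.toLinearMap := by
    rintro _ ⟨e, rfl⟩
    exact h.fderiv_sub_comp_paramDeriv hω hz e
  have hr := LinearMap.finrank_range_of_inj
    (f := (paramDeriv ψ z).toLinearMap) (h.paramDeriv_injective hz)
  rw [finrank_euclideanSpace_fin] at hk hr
  have heq := Submodule.eq_of_le_of_finrank_eq hle (by omega)
  have : y ∈ LinearMap.range (paramDeriv ψ z).toLinearMap := by
    rw [heq]
    exact hy
  exact this

theorem locallyIntegrable_comp_fst_add_comp_snd {X : Type*} [NormedAddCommGroup X]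
    [NormedSpace ℝ X] [FiniteDimensional ℝ X] [MeasureSpace X] [BorelSpace X]
    [IsLocallyFiniteMeasure (volume : Measure X)] [SFinite (volume : Measure X)] {g : X → ℝ}
    (hg : LocallyIntegrable g volume) :
    LocallyIntegrable (fun z : X × X => g z.1) volume ∧
      LocallyIntegrable (fun z : X × X => g z.2) volume := by
  have key : ∀ K : Set (X × X), IsCompact K →
      IntegrableOn (fun z : X × X => g z.1) K ∧ IntegrableOn (fun z : X × X => g z.2) K := by
    intro K hK
    have h1 := hK.image continuous_fst
    have h2 := hK.image continuous_snd
    have hsub : K ⊆ (Prod.fst '' K) ×ˢ (Prod.snd '' K) :=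
      fun z hz => ⟨⟨z, hz, rfl⟩, ⟨z, hz, rfl⟩⟩
    have : IsFiniteMeasure (volume.restrict (Prod.fst '' K) : Measure X) :=
      ⟨by simpa using h1.measure_lt_top⟩
    have : IsFiniteMeasure (volume.restrict (Prod.snd '' K) : Measure X) :=
      ⟨by simpa using h2.measure_lt_top⟩
    constructor
    · refine IntegrableOn.mono_set ?_ hsub
      rw [IntegrableOn, Measure.volume_eq_prod, ← Measure.prod_restrict]
      exact Integrable.comp_fst (hg.integrableOn_isCompact h1) _
    · refine IntegrableOn.mono_set ?_ hsub
      rw [IntegrableOn, Measure.volume_eq_prod, ← Measure.prod_restrict]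
      exact Integrable.comp_snd (hg.integrableOn_isCompact h2) _
  exact ⟨locallyIntegrable_iff.2 fun K hK => (key K hK).1,
    locallyIntegrable_iff.2 fun K hK => (key K hK).2⟩

/-- Tangent vector fields of the collision manifolds lift to the parameter space with `C¹`
dependence. -/
theorem IsCollisionParam.exists_contDiff_lift (hd : 1 ≤ d) (h : IsCollisionParam ω p U V ψ)
    (hω : ContDiffOn ℝ 2 ω {v | v ≠ 0}) :
    ∃ r > 0, Metric.ball p r ⊆ U ∧ ∀ (a b : Vel d) (χ : Vel d × Vel d → ℝ), ContDiff ℝ 1 χ →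
      tsupport χ ⊆ Metric.ball p r → ∃ W : Vel d × Vel d → Vel (d - 1), ContDiff ℝ 1 W ∧
        tsupport W ⊆ tsupport χ ∧
        ∀ z, paramDeriv ψ z (W z) = χ z • (derivDiff ω b z • a - derivDiff ω a z • b) := by
  -- L is a left inverse of M(z) = D_σψ(z) at z = p only, but L M(z) remains invertible nearby. Then
  -- (L M(z))⁻¹ L, which is C¹ in z, recovers the preimage of any vector in the range of M(z).
  obtain ⟨L, hL⟩ := ContinuousLinearMap.HasLeftInverse.of_injective_of_finiteDimensional
    (h.paramDeriv_injective (mem_of_mem_nhds h.nhds_U))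
  have hM := contDiff_paramDeriv h.contDiff
  have hN : ContDiff ℝ 1 fun z => L.comp (paramDeriv ψ z) := contDiff_const.clm_comp hM
  have hNp : L.comp (paramDeriv ψ p) = ContinuousLinearMap.id ℝ _ := by
    ext1 e
    exact hL e
  have hunit : ∀ᶠ z in 𝓝 p, IsUnit (L.comp (paramDeriv ψ z)) := by
    refine hN.continuous.continuousAt.eventually (Units.isOpen.mem_nhds ?_)
    change IsUnit (L.comp (paramDeriv ψ p))
    rw [hNp]
    exact isUnit_one
  obtain ⟨r, hr, hball⟩ := Metric.mem_nhds_iff.1 (hunit.and h.nhds_U)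
  have hpun : ∀ z ∈ Metric.ball p r, z ∈ puncturedPairs d := fun z hz =>
    (h.subset_U (hball hz).2).1
  refine ⟨r, hr, fun z hz => (hball hz).2, fun a b χ hχ hs => ?_⟩
  refine ⟨fun z => χ z • Ring.inverse (L.comp (paramDeriv ψ z))
    (L (derivDiff ω b z • a - derivDiff ω a z • b)), ?_, ?_, fun z => ?_⟩
  · refine contDiff_smul_of_contDiffAt hχ fun z hz => ?_
    have hz' := hs hz
    obtain ⟨u, hu⟩ := (hball hz').1
    have hinv : ContDiffAt ℝ 1 (fun z => Ring.inverse (L.comp (paramDeriv ψ z))) z := by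
      refine ContDiffAt.comp z (g := Ring.inverse) ?_ hN.contDiffAt
      rw [← hu]
      exact contDiffAt_ringInverse ℝ u
    have hc := fun a => contDiffAt_derivDiff hω a (hpun z hz')
    exact hinv.clm_apply (L.contDiff.contDiffAt.comp z
      (((hc b).smul contDiffAt_const).sub ((hc a).smul contDiffAt_const)))
  · refine closure_mono fun z hz => ?_
    contrapose hz
    simp [Function.notMem_support.1 hz]
  · by_cases hz : z ∈ tsupport χ
    · have hz' := hs hz
      have hu := (hball hz').1
      obtain ⟨e, he⟩ := h.exists_paramDeriv_eq hd hω (hball hz').2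
        (y := derivDiff ω b z • a - derivDiff ω a z • b) (by
          simp only [map_sub, map_smul, sub_apply, smul_eq_mul, derivDiff]
          ring)
      have hinv : Ring.inverse (L.comp (paramDeriv ψ z)) (L (paramDeriv ψ z e)) = e :=
        congrArg (fun T : Vel (d - 1) →L[ℝ] Vel (d - 1) => T e) (Ring.inverse_mul_cancel _ hu)
      beta_reduce
      rw [← he, hinv, map_smul]
    · simp [image_eq_zero_of_notMem_tsupport hz]

/-- The infinitesimal form of the invariance of `g`, tested near a point of the collision set. -/
theorem exists_ball_integral_mul_collisionForm_eq_zero (hd : 1 ≤ d)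
    (h : IsCollisionParam ω p U V ψ) (hω : ContDiffOn ℝ 2 ω {v | v ≠ 0}) {g : Vel d → ℝ}
    (hg : LocallyIntegrable g volume)
    (hinv : ∀ᵐ q : Vel d × Vel d, q ∈ U → ∀ᵐ σ : Vel (d - 1), σ ∈ V →
      g q.1 + g q.2 = g (q.1 - ψ (q.1, q.2, σ)) + g (q.2 + ψ (q.1, q.2, σ))) :
    ∃ r > 0, ∀ χ : Vel d × Vel d → ℝ, ContDiff ℝ 1 χ → tsupport χ ⊆ Metric.ball p r →
      ∀ a b, ∫ z, (g z.1 + g z.2) * collisionForm ω a b χ z = 0 := by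
  set Ψ : (Vel d × Vel d) × Vel (d - 1) → Vel d × Vel d := fun x =>
    (x.1.1 - ψ (x.1.1, x.1.2, x.2), x.1.2 + ψ (x.1.1, x.1.2, x.2)) with hΨdef
  have hassoc : ContDiff ℝ 2 fun x : (Vel d × Vel d) × Vel (d - 1) => (x.1.1, x.1.2, x.2) := by
    fun_prop
  have hψΨ := h.contDiff.comp hassoc
  have hΨ : ContDiff ℝ 2 Ψ :=
    ((contDiff_fst.comp contDiff_fst).sub hψΨ).prodMk ((contDiff_snd.comp contDiff_fst).add hψΨ)
  have hG := locallyIntegrable_comp_fst_add_comp_snd hg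
  have hderiv : ∀ (z : Vel d × Vel d) (e : Vel (d - 1)),
      fderiv ℝ Ψ (z, 0) (0, e) = (-paramDeriv ψ z e, paramDeriv ψ z e) := by
    intro z e
    have hψd := h.contDiff.differentiable two_ne_zero
    have hψ : HasFDerivAt (fun σ : Vel (d - 1) => ψ (z.1, z.2, σ)) (paramDeriv ψ z) 0 :=
      (hψd.comp (f := fun σ : Vel (d - 1) => (z.1, z.2, σ)) (by fun_prop) 0).hasFDerivAt
    have h1 : HasFDerivAt (fun σ : Vel (d - 1) => Ψ (z, σ)) _ 0 :=
      (hψ.const_sub z.1).prodMk (hψ.const_add z.2)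
    have h2 := ((hΨ.differentiable two_ne_zero (z, 0)).hasFDerivAt.comp (0 : Vel (d - 1))
      (hasFDerivAt_prodMk_right z (0 : Vel (d - 1)))).unique h1
    simpa using congrArg (fun T : Vel (d - 1) →L[ℝ] Vel d × Vel d => T e) h2
  have : (volume : Measure (Vel d × Vel d)).IsAddHaarMeasure :=
    Measure.prod.instIsAddHaarMeasure _ _
  obtain ⟨r₁, hr₁, hkey⟩ := integral_mul_trace_fderiv_eq_zero_of_vectorField volume volume hΨ
    h.nhds_U h.nhds_V (fun z hz => by simp [Ψ, h.map_zero z.1 z.2 hz])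
    (G := fun z => g z.1 + g z.2) (hG.1.add hG.2) hinv
  obtain ⟨r₂, hr₂, hball, hlift⟩ := h.exists_contDiff_lift hd hω
  refine ⟨min r₁ r₂, lt_min hr₁ hr₂, fun χ hχ hs a b => ?_⟩
  obtain ⟨W, hW, hWs, hWM⟩ := hlift a b χ hχ
    (hs.trans (Metric.ball_subset_ball (min_le_right _ _)))
  have h0 := hkey W hW (hWs.trans (hs.trans (Metric.ball_subset_ball (min_le_left _ _))))
  have hsp : tsupport χ ⊆ puncturedPairs d := fun z hz =>
    (h.subset_U (hball (Metric.ball_subset_ball (min_le_right _ _) (hs hz)))).1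
  rw [← h0]
  refine integral_congr_ae (.of_forall fun z => ?_)
  -- The velocity is (-y, y) with y = χ (δ_b a - δ_a b), that is, χ times the field of
  -- `collisionForm`.
  have hfun : (fun y => fderiv ℝ Ψ (y, 0) (0, W y)) = fun y => χ y •
      (derivDiff ω a y • ((b, -b) : Vel d × Vel d) - derivDiff ω b y • (a, -a)) := by
    funext y
    rw [hderiv, hWM]
    ext1
    · simp only [Prod.smul_fst, Prod.fst_sub, ← smul_neg, neg_sub]
    · simp only [Prod.smul_snd, Prod.snd_sub, smul_neg]
      congr 1
      abel
  simp only [hfun, trace_fderiv_smul_tangent hω a b hχ hsp]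

end LocalIdentity

/-! ### Gluing by a partition of unity -/

section Localization

/-- A property of `C¹` test functions which is stable under sums holds for a compactly supported
test function as soon as it holds locally on its support. -/
theorem property_of_locally {X : Type*} [NormedAddCommGroup X] [NormedSpace ℝ X]
    [FiniteDimensional ℝ X] {P : (X → ℝ) → Prop} {K : Set X} (hK : IsCompact K)
    (hzero : P fun _ => 0)
    (hadd : ∀ χ₁ χ₂ : X → ℝ, ContDiff ℝ 1 χ₁ → ContDiff ℝ 1 χ₂ → tsupport χ₁ ⊆ K →
      tsupport χ₂ ⊆ K → P χ₁ → P χ₂ → P (χ₁ + χ₂))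
    (hloc : ∀ p ∈ K, ∃ r > 0, ∀ χ : X → ℝ, ContDiff ℝ 1 χ → tsupport χ ⊆ K →
      tsupport χ ⊆ Metric.ball p r → P χ)
    {χ : X → ℝ} (hχ : ContDiff ℝ 1 χ) (hs : tsupport χ ⊆ K) : P χ := by
  choose! r hr hP using hloc
  obtain ⟨t, htK, htc⟩ := hK.elim_nhds_subcover (fun p => Metric.ball p (r p))
    fun p hp => Metric.ball_mem_nhds p (hr p hp)
  obtain ⟨f, hf⟩ := SmoothPartitionOfUnity.exists_isSubordinate (modelWithCornersSelf ℝ X)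
    hK.isClosed (fun p : t => Metric.ball p.1 (r p.1)) (fun _ => Metric.isOpen_ball)
    (by simpa [Set.iUnion_subtype] using htc)
  have hsum : χ = ∑ i, fun x => f i x * χ x := by
    funext x
    rw [Finset.sum_apply, ← Finset.sum_mul]
    by_cases hx : x ∈ K
    · have := f.sum_eq_one hx
      rw [finsum_eq_sum_of_fintype] at this
      rw [this, one_mul]
    · rw [image_eq_zero_of_notMem_tsupport fun h => hx (hs h), mul_zero]
  have hfC : ∀ i, ContDiff ℝ 1 fun x => f i x * χ x := fun i =>
    ((f i).contMDiff.contDiff.of_le (by simp)).mul hχ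
  have hfs : ∀ i, tsupport (fun x => f i x * χ x) ⊆ K := fun i =>
    (tsupport_mul_subset_right (f := fun x => f i x)).trans hs
  have key : ContDiff ℝ 1 (∑ i, fun x => f i x * χ x) ∧ tsupport (∑ i, fun x => f i x * χ x) ⊆ K ∧
      P (∑ i, fun x => f i x * χ x) := by
    refine Finset.sum_induction (fun i : t => fun x => f i x * χ x)
      (fun φ => ContDiff ℝ 1 φ ∧ tsupport φ ⊆ K ∧ P φ) ?_ ?_ ?_
    · rintro φ₁ φ₂ ⟨a1, a2, a3⟩ ⟨b1, b2, b3⟩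
      exact ⟨a1.add b1, (tsupport_add φ₁ φ₂).trans (Set.union_subset a2 b2),
        hadd φ₁ φ₂ a1 b1 a2 b2 a3 b3⟩
    · refine ⟨contDiff_const, ?_, hzero⟩
      simp [tsupport]
    · intro i _
      exact ⟨hfC i, hfs i, hP i.1 (htK i.1 i.2) _ (hfC i) (hfs i)
        ((tsupport_mul_subset_left (f := fun x => f i x)).trans (hf i))⟩
  rw [hsum]
  exact key.2.2

end Localization

/-! ### Test functions whose support may leave the collision set -/

section CollisionFormIntegral

variable {d : ℕ} {ω : Vel d → ℝ}

theorem continuous_collisionForm (hω : ContDiffOn ℝ 2 ω {v | v ≠ 0}) (a b : Vel d)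
    {χ : Vel d × Vel d → ℝ} (hχ : ContDiff ℝ 1 χ) (hs : tsupport χ ⊆ puncturedPairs d) :
    Continuous (collisionForm ω a b χ) := by
  rw [funext (collisionForm_eq_sub hω a b hχ hs)]
  have h := fun a => (contDiff_mul_derivDiff hω a hχ hs).continuous_fderiv one_ne_zero
  exact ((h a).clm_apply continuous_const).sub ((h b).clm_apply continuous_const)

theorem collisionForm_eq_zero (a b : Vel d) {χ : Vel d × Vel d → ℝ} {z : Vel d × Vel d}
    (hz : z ∉ tsupport χ) : collisionForm ω a b χ z = 0 := by
  rw [collisionForm, (notMem_tsupport_iff_eventuallyEq.1 hz).fderiv_eq]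
  simp

theorem integrable_mul_collisionForm (hω : ContDiffOn ℝ 2 ω {v | v ≠ 0}) (a b : Vel d)
    {G : Vel d × Vel d → ℝ} (hG : LocallyIntegrable G volume)
    {χ : Vel d × Vel d → ℝ} (hχ : ContDiff ℝ 1 χ) (hs : tsupport χ ⊆ puncturedPairs d)
    (hc : HasCompactSupport χ) : Integrable (fun z => G z * collisionForm ω a b χ z) volume := by
  have h : HasCompactSupport (collisionForm ω a b χ) :=
    HasCompactSupport.of_support_subset_isCompact hc fun z hz => by
      by_contra h
      exact hz (collisionForm_eq_zero a b h)
  simpa [mul_comm] using hG.integrable_smul_left_of_hasCompactSupport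
    (continuous_collisionForm hω a b hχ hs) h

theorem collisionForm_add (a b : Vel d) {χ₁ χ₂ : Vel d × Vel d → ℝ} (h₁ : Differentiable ℝ χ₁)
    (h₂ : Differentiable ℝ χ₂) (z : Vel d × Vel d) :
    collisionForm ω a b (χ₁ + χ₂) z = collisionForm ω a b χ₁ z + collisionForm ω a b χ₂ z := by
  simp only [collisionForm, fderiv_add (h₁ z) (h₂ z), add_apply]
  ring

theorem integral_mul_collisionForm_eq_zero_of_subset_collisionSet (hd : 1 ≤ d)
    (hω : ContDiffOn ℝ 2 ω {v | v ≠ 0}) {g : Vel d → ℝ} (hg : LocallyIntegrable g volume)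
    (hinv : IsAECollisionInvariant ω g) (a b : Vel d) {χ : Vel d × Vel d → ℝ}
    (hχ : ContDiff ℝ 1 χ) (hc : HasCompactSupport χ) (hs : tsupport χ ⊆ collisionSet ω) :
    ∫ z, (g z.1 + g z.2) * collisionForm ω a b χ z = 0 := by
  have hG := locallyIntegrable_comp_fst_add_comp_snd hg
  have hsp : tsupport χ ⊆ puncturedPairs d := fun z hz => (hs hz).1
  refine property_of_locally (K := tsupport χ)
    (P := fun χ => ∫ z, (g z.1 + g z.2) * collisionForm ω a b χ z = 0) hc ?_ ?_ ?_ hχ subset_rfl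
  · simp [collisionForm]
  · intro χ₁ χ₂ h₁ h₂ s₁ s₂ e₁ e₂
    have i₁ := integrable_mul_collisionForm hω a b (hG.1.add hG.2) h₁ (s₁.trans hsp)
      (hc.of_isClosed_subset (isClosed_tsupport _) s₁)
    have i₂ := integrable_mul_collisionForm hω a b (hG.1.add hG.2) h₂ (s₂.trans hsp)
      (hc.of_isClosed_subset (isClosed_tsupport _) s₂)
    have := integral_add i₁ i₂
    simp only [Pi.add_apply] at this
    rw [e₁, e₂, add_zero] at this
    rw [← this]
    refine integral_congr_ae (.of_forall fun z => ?_)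
    simp only [collisionForm_add a b (h₁.differentiable one_ne_zero)
      (h₂.differentiable one_ne_zero)]
    ring
  · intro p hp
    obtain ⟨U, V, ψ, hparam, hae⟩ := hinv p (hs hp)
    obtain ⟨r, hr, h⟩ := exists_ball_integral_mul_collisionForm_eq_zero hd hparam hω hg hae
    exact ⟨r, hr, fun χ' hχ' _ hball => h χ' hχ' hball a b⟩

/-- A smooth cutoff equal to `0` on `(-∞, 1]` and to `1` on `[2, ∞)`. -/
noncomputable def cutoff (t : ℝ) : ℝ := Real.smoothTransition (t - 1)

theorem contDiff_cutoff {n : ℕ∞} : ContDiff ℝ n cutoff :=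
  Real.smoothTransition.contDiff.comp (contDiff_id.sub contDiff_const)

theorem cutoff_of_le {t : ℝ} (h : t ≤ 1) : cutoff t = 0 :=
  Real.smoothTransition.zero_of_nonpos (by linarith)

theorem cutoff_of_ge {t : ℝ} (h : 2 ≤ t) : cutoff t = 1 :=
  Real.smoothTransition.one_of_one_le (by linarith)

theorem abs_cutoff_le (t : ℝ) : |cutoff t| ≤ 1 := by
  rw [cutoff, abs_of_nonneg (Real.smoothTransition.nonneg _)]
  exact Real.smoothTransition.le_one _

theorem deriv_cutoff_of_lt {t : ℝ} (h : t < 1) : deriv cutoff t = 0 := by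
  have : cutoff =ᶠ[𝓝 t] fun _ => 0 := by
    filter_upwards [gt_mem_nhds h] with s hs using cutoff_of_le hs.le
  rw [this.deriv_eq, deriv_const]

theorem deriv_cutoff_of_gt {t : ℝ} (h : 2 < t) : deriv cutoff t = 0 := by
  have : cutoff =ᶠ[𝓝 t] fun _ => 1 := by
    filter_upwards [lt_mem_nhds h] with s hs using cutoff_of_ge hs.le
  rw [this.deriv_eq, deriv_const]

/-- The derivative of `cutoff` lives on [1, 2]. The factor t makes the bound invariant under
scaling, hence uniform in n for cutoff(nN). -/
theorem exists_abs_mul_deriv_cutoff_le : ∃ M, 0 ≤ M ∧ ∀ t, |t * deriv cutoff t| ≤ M := by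
  have hc : Continuous fun t => t * deriv cutoff t :=
    continuous_id.mul ((contDiff_cutoff (n := 1)).continuous_deriv (by simp))
  obtain ⟨M, hM⟩ := (isCompact_Icc (a := (1 : ℝ)) (b := 2)).exists_bound_of_continuousOn
    hc.continuousOn
  refine ⟨max M 0, le_max_right _ _, fun t => ?_⟩
  by_cases ht : t ∈ Set.Icc (1 : ℝ) 2
  · exact (hM t ht).trans (le_max_left _ _)
  · rw [Set.mem_Icc, not_and_or, not_le, not_le] at ht
    rcases ht with ht | ht
    · simp [deriv_cutoff_of_lt ht]
    · simp [deriv_cutoff_of_gt ht]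

/-- The squared size of the pair of differences `∂_a ω(v) - ∂_a ω(v_*)`,
`∂_b ω(v) - ∂_b ω(v_*)`. -/
noncomputable def derivDiffSq (ω : Vel d → ℝ) (a b : Vel d) (z : Vel d × Vel d) : ℝ :=
  derivDiff ω a z ^ 2 + derivDiff ω b z ^ 2

theorem contDiffAt_derivDiffSq (hω : ContDiffOn ℝ 2 ω {v | v ≠ 0}) (a b : Vel d)
    {z : Vel d × Vel d} (hz : z ∈ puncturedPairs d) : ContDiffAt ℝ 1 (derivDiffSq ω a b) z :=
  ((contDiffAt_derivDiff hω a hz).pow 2).add ((contDiffAt_derivDiff hω b hz).pow 2)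

theorem fderiv_derivDiffSq (hω : ContDiffOn ℝ 2 ω {v | v ≠ 0}) (a b : Vel d)
    {z : Vel d × Vel d} (hz : z ∈ puncturedPairs d) (e : Vel d × Vel d) :
    fderiv ℝ (derivDiffSq ω a b) z e = 2 * derivDiff ω a z * fderiv ℝ (derivDiff ω a) z e
      + 2 * derivDiff ω b z * fderiv ℝ (derivDiff ω b) z e := by
  have h := fun a => ((contDiffAt_derivDiff hω a hz).differentiableAt one_ne_zero).hasFDerivAt
  have h' : HasFDerivAt (derivDiffSq ω a b) _ z := ((h a).pow 2).add ((h b).pow 2)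
  rw [h'.fderiv]
  simp

theorem mem_collisionSet_of_derivDiffSq_ne_zero {a b : Vel d} {z : Vel d × Vel d}
    (hz : z ∈ puncturedPairs d) (h : derivDiffSq ω a b z ≠ 0) : z ∈ collisionSet ω := by
  refine ⟨hz, fun heq => h ?_⟩
  have : fderiv ℝ ω z.1 = fderiv ℝ ω z.2 := (InnerProductSpace.toDual ℝ (Vel d)).symm.injective heq
  simp [derivDiffSq, derivDiff, this]

/-- The quotient by the squared size of the derivative of `derivDiffSq` along the tangent field
is bounded on compact sets. -/
theorem exists_abs_collisionForm_derivDiffSq_le (hω : ContDiffOn ℝ 2 ω {v | v ≠ 0}) (a b : Vel d)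
    {K : Set (Vel d × Vel d)} (hK : IsCompact K) (hKp : K ⊆ puncturedPairs d) :
    ∃ C, 0 ≤ C ∧ ∀ z ∈ K,
      |collisionForm ω a b (derivDiffSq ω a b) z| ≤ C * derivDiffSq ω a b z := by
  have hc : ∀ a e, ContinuousOn (fun z => fderiv ℝ (derivDiff ω a) z e) K := fun a e z hz =>
    ((((contDiffAt_derivDiff hω a (hKp hz)).fderiv_right (m := 0) (by simp)).continuousAt).clm_apply
      continuousAt_const).continuousWithinAt
  have hb : ∀ a e, ∃ C, 0 ≤ C ∧ ∀ z ∈ K, |fderiv ℝ (derivDiff ω a) z e| ≤ C := fun a e => by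
    obtain ⟨C, hC⟩ := hK.exists_bound_of_continuousOn (hc a e)
    exact ⟨max C 0, le_max_right _ _, fun z hz => (hC z hz).trans (le_max_left _ _)⟩
  obtain ⟨C₁, hC₁, h₁⟩ := hb a (b, -b)
  obtain ⟨C₂, hC₂, h₂⟩ := hb b (b, -b)
  obtain ⟨C₃, hC₃, h₃⟩ := hb a (a, -a)
  obtain ⟨C₄, hC₄, h₄⟩ := hb b (a, -a)
  refine ⟨2 * C₁ + C₂ + C₃ + 2 * C₄, by positivity, fun z hz => ?_⟩
  have k₁ := h₁ z hz
  have k₂ := h₂ z hz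
  have k₃ := h₃ z hz
  have k₄ := h₄ z hz
  rw [collisionForm, fderiv_derivDiffSq hω a b (hKp hz), fderiv_derivDiffSq hω a b (hKp hz),
    derivDiffSq]
  generalize fderiv ℝ (derivDiff ω a) z (b, -b) = t₁ at *
  generalize fderiv ℝ (derivDiff ω b) z (b, -b) = t₂ at *
  generalize fderiv ℝ (derivDiff ω a) z (a, -a) = t₃ at *
  generalize fderiv ℝ (derivDiff ω b) z (a, -a) = t₄ at *
  generalize derivDiff ω a z = x
  generalize derivDiff ω b z = y
  -- The field and the differential of x² + y² are both linear in (x, y), so every term is quadratic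
  -- and is absorbed by x² + y².
  have hxy : |2 * x * y| ≤ x ^ 2 + y ^ 2 := by
    rw [abs_le]
    constructor <;> nlinarith [sq_nonneg (x + y), sq_nonneg (x - y)]
  have e : x * (2 * x * t₁ + 2 * y * t₂) - y * (2 * x * t₃ + 2 * y * t₄)
      = 2 * x ^ 2 * t₁ + (2 * x * y) * t₂ - (2 * x * y) * t₃ - 2 * y ^ 2 * t₄ := by ring
  rw [e]
  have b₁ : |2 * x ^ 2 * t₁| ≤ 2 * (x ^ 2 + y ^ 2) * C₁ := by
    rw [abs_mul, abs_of_nonneg (by positivity : (0 : ℝ) ≤ 2 * x ^ 2)]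
    exact mul_le_mul (by nlinarith [sq_nonneg y]) k₁ (abs_nonneg _) (by positivity)
  have b₂ : |(2 * x * y) * t₂| ≤ (x ^ 2 + y ^ 2) * C₂ := by
    rw [abs_mul]
    exact mul_le_mul hxy k₂ (abs_nonneg _) (by positivity)
  have b₃ : |(2 * x * y) * t₃| ≤ (x ^ 2 + y ^ 2) * C₃ := by
    rw [abs_mul]
    exact mul_le_mul hxy k₃ (abs_nonneg _) (by positivity)
  have b₄ : |2 * y ^ 2 * t₄| ≤ 2 * (x ^ 2 + y ^ 2) * C₄ := by
    rw [abs_mul, abs_of_nonneg (by positivity : (0 : ℝ) ≤ 2 * y ^ 2)]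
    exact mul_le_mul (by nlinarith [sq_nonneg x]) k₄ (abs_nonneg _) (by positivity)
  rw [abs_le] at *
  constructor <;> linarith [b₁.1, b₁.2, b₂.1, b₂.2, b₃.1, b₃.2, b₄.1, b₄.2]

theorem collisionForm_mul_cutoff (hω : ContDiffOn ℝ 2 ω {v | v ≠ 0}) (a b : Vel d)
    {χ : Vel d × Vel d → ℝ} (hχ : ContDiff ℝ 1 χ) (n : ℝ) {z : Vel d × Vel d}
    (hz : z ∈ puncturedPairs d) :
    collisionForm ω a b (fun z => χ z * cutoff (n * derivDiffSq ω a b z)) z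
      = cutoff (n * derivDiffSq ω a b z) * collisionForm ω a b χ z
        + χ z * (deriv cutoff (n * derivDiffSq ω a b z) * n)
          * collisionForm ω a b (derivDiffSq ω a b) z := by
  have h1 := (hχ.differentiable one_ne_zero z).hasFDerivAt
  have h2 := ((contDiffAt_derivDiffSq hω a b hz).differentiableAt one_ne_zero).hasFDerivAt
  have h3 := (((contDiff_cutoff (n := 1)).differentiable (by simp)
    (n * derivDiffSq ω a b z)).hasDerivAt).comp_hasFDerivAt z (h2.const_mul n)
  have h4 : HasFDerivAt (fun z => χ z * cutoff (n * derivDiffSq ω a b z)) _ z := h1.mul h3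
  simp only [collisionForm, h4.fderiv, add_apply, smul_apply, smul_eq_mul]
  ring

/-- Replace χ by χ cutoff(nN) with N = `derivDiffSq`, supported in the collision set. The extra term
χ cutoff'(nN) n ZN is bounded uniformly in n because |ZN| ≤ CN on the support of χ. Pointwise, Z = 0
where N = 0, and the cutoff is 1 once nN > 2 elsewhere, so dominated convergence applies. -/
theorem integral_mul_collisionForm_eq_zero (hd : 1 ≤ d)
    (hω : ContDiffOn ℝ 2 ω {v | v ≠ 0}) {g : Vel d → ℝ} (hg : LocallyIntegrable g volume)
    (hinv : IsAECollisionInvariant ω g) (a b : Vel d) {χ : Vel d × Vel d → ℝ}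
    (hχ : ContDiff ℝ 1 χ) (hc : HasCompactSupport χ) (hs : tsupport χ ⊆ puncturedPairs d) :
    ∫ z, (g z.1 + g z.2) * collisionForm ω a b χ z = 0 := by
  have hG := locallyIntegrable_comp_fst_add_comp_snd hg
  set N := derivDiffSq ω a b with hN
  set χc : ℕ → Vel d × Vel d → ℝ := fun n z => χ z * cutoff (n * N z) with hχcdef
  have hN0 : ∀ z, 0 ≤ N z := fun z => by simp only [hN, derivDiffSq]; positivity
  have hsc : ∀ n, tsupport (χc n) ⊆ tsupport χ := fun n => tsupport_mul_subset_left
  have hχc : ∀ n, ContDiff ℝ 1 (χc n) := fun n =>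
    contDiff_smul_of_contDiffAt hχ fun z hz => (contDiff_cutoff (n := 1)).contDiffAt.comp z
      (contDiffAt_const.mul (contDiffAt_derivDiffSq hω a b (hs hz)))
  have hsA : ∀ n, tsupport (χc n) ⊆ collisionSet ω := fun n z hz => by
    have hzp := hs (hsc n hz)
    refine mem_collisionSet_of_derivDiffSq_ne_zero (a := a) (b := b) hzp fun h0 => ?_
    refine absurd hz (notMem_tsupport_iff_eventuallyEq.2 ?_)
    have hcont : ContinuousAt (fun z => (n : ℝ) * N z) z :=
      continuousAt_const.mul (contDiffAt_derivDiffSq hω a b hzp).continuousAt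
    have hlt : (n : ℝ) * N z < 1 := by
      rw [hN, h0]
      norm_num
    filter_upwards [hcont.eventually (gt_mem_nhds hlt)] with y hy
    simp [χc, cutoff_of_le hy.le]
  have hzero : ∀ n, ∫ z, (g z.1 + g z.2) * collisionForm ω a b (χc n) z = 0 := fun n =>
    integral_mul_collisionForm_eq_zero_of_subset_collisionSet hd hω hg hinv a b (hχc n)
      (hc.of_isClosed_subset (isClosed_tsupport _) (hsc n)) (hsA n)
  obtain ⟨M, hM0, hM⟩ := exists_abs_mul_deriv_cutoff_le
  obtain ⟨C, hC0, hC⟩ := exists_abs_collisionForm_derivDiffSq_le hω a b hc hs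
  obtain ⟨B, hB⟩ := hc.exists_bound_of_continuousOn hχ.continuous.continuousOn
  obtain ⟨D, hD⟩ := hc.exists_bound_of_continuousOn
    (continuous_collisionForm hω a b hχ hs).continuousOn
  have hbound : ∀ n, ∀ z ∈ tsupport χ, |collisionForm ω a b (χc n) z| ≤ D + B * (M * C) := by
    intro n z hz
    rw [hχcdef, collisionForm_mul_cutoff hω a b hχ n (hs hz)]
    refine (abs_add_le _ _).trans (add_le_add ?_ ?_)
    · rw [abs_mul]
      exact (mul_le_of_le_one_left (abs_nonneg _) (abs_cutoff_le _)).trans (hD z hz)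
    · rw [mul_assoc, abs_mul]
      refine mul_le_mul (hB z hz) ?_ (abs_nonneg _) ((norm_nonneg _).trans (hB z hz))
      rw [abs_mul]
      calc _ ≤ |deriv cutoff (n * N z) * n| * (C * N z) :=
            mul_le_mul_of_nonneg_left (hC z hz) (abs_nonneg _)
        _ = |n * N z * deriv cutoff (n * N z)| * C := by
            simp only [abs_mul, abs_of_nonneg (hN0 z)]
            ring
        _ ≤ M * C := mul_le_mul_of_nonneg_right (hM _) hC0
  have hlim : Filter.Tendsto
      (fun n : ℕ => ∫ z, (g z.1 + g z.2) * collisionForm ω a b (χc n) z) Filter.atTop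
      (𝓝 (∫ z, (g z.1 + g z.2) * collisionForm ω a b χ z)) := by
    refine tendsto_integral_of_dominated_convergence
      ((tsupport χ).indicator fun z => |g z.1 + g z.2| * (D + B * (M * C))) ?_ ?_ ?_ ?_
    · exact fun n => (integrable_mul_collisionForm hω a b (hG.1.add hG.2) (hχc n)
        ((hsc n).trans hs)
        (hc.of_isClosed_subset (isClosed_tsupport _) (hsc n))).aestronglyMeasurable
    · rw [integrable_indicator_iff (isClosed_tsupport χ).measurableSet]
      exact (((hG.1.add hG.2).integrableOn_isCompact hc).norm).mul_const _
    · refine fun n => .of_forall fun z => ?_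
      by_cases hz : z ∈ tsupport χ
      · rw [Set.indicator_of_mem hz, norm_mul]
        exact mul_le_mul_of_nonneg_left (hbound n z hz) (norm_nonneg _)
      · rw [Set.indicator_of_notMem hz, collisionForm_eq_zero a b fun h => hz (hsc n h)]
        simp
    · refine .of_forall fun z => ?_
      refine Filter.Tendsto.const_mul _ ?_
      by_cases hz : z ∈ tsupport χ
      · by_cases hNz : N z = 0
        · have h0 : derivDiff ω a z = 0 ∧ derivDiff ω b z = 0 := by
            simp only [hN, derivDiffSq] at hNz
            constructor <;> nlinarith [sq_nonneg (derivDiff ω a z), sq_nonneg (derivDiff ω b z)]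
          simp [collisionForm, h0]
        · have hpos : 0 < N z := lt_of_le_of_ne (hN0 z) (Ne.symm hNz)
          have hev : ∀ᶠ n : ℕ in Filter.atTop, 2 < n * N z :=
            (tendsto_natCast_atTop_atTop.atTop_mul_const hpos).eventually_gt_atTop 2
          refine tendsto_const_nhds.congr' ?_
          filter_upwards [hev] with n hn
          rw [hχcdef, collisionForm_mul_cutoff hω a b hχ n (hs hz), cutoff_of_ge hn.le,
            deriv_cutoff_of_gt hn]
          simp
      · rw [collisionForm_eq_zero a b hz]
        refine tendsto_const_nhds.congr fun n => ?_
        rw [collisionForm_eq_zero a b fun h => hz (hsc n h)]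
  simp only [hzero] at hlim
  exact (tendsto_nhds_unique hlim tendsto_const_nhds)

end CollisionFormIntegral

/-! ### Solving the symmetric bilinear relation -/

section LinearAlgebra

variable {D : Type*} [AddCommGroup D] [Module ℝ D]

/-- If the joint map to ℝⁿ were not onto, a nonzero functional vanishing on its range would give a
linear relation among the l i. -/
theorem exists_dual_vectors {n : ℕ} {l : Fin n → D →ₗ[ℝ] ℝ} (hl : LinearIndependent ℝ l) :
    ∃ x : Fin n → D, ∀ i j, l i (x j) = if i = j then 1 else 0 := by
  have htop : LinearMap.range (LinearMap.pi l) = ⊤ := by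
    by_contra hne
    obtain ⟨f, hf0, hf⟩ := Submodule.exists_le_ker_of_lt_top _ (lt_top_iff_ne_top.2 hne)
    have hsum : ∑ i, f (Pi.single i 1) • l i = 0 := by
      ext φ
      have h1 : f (LinearMap.pi l φ) = 0 := hf ⟨φ, rfl⟩
      rw [LinearMap.pi_apply_eq_sum_univ f] at h1
      have hsingle : ∀ i : Fin n, (fun j => if i = j then (1 : ℝ) else 0) = Pi.single i 1 :=
        fun i => by
          ext j
          simp [Pi.single_apply, eq_comm]
      simpa [mul_comm, hsingle] using h1
    have h0 := Fintype.linearIndependent_iff.1 hl _ hsum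
    refine hf0 (LinearMap.pi_ext' fun i => LinearMap.ext_ring ?_)
    simpa using h0 i
  have hs := LinearMap.range_eq_top.1 htop
  choose x hx using fun j : Fin n => hs (Pi.single j 1)
  refine ⟨x, fun i j => ?_⟩
  have := congrFun (hx j) i
  simpa [Pi.single_apply] using this

/-- The symmetrization of a combination of tensor products of functionals. -/
def SymmetricRelation (A B C u p q : D →ₗ[ℝ] ℝ) : Prop :=
  ∀ φ φ', A φ * u φ' - B φ * p φ' + C φ * q φ' + (A φ' * u φ - B φ' * p φ + C φ' * q φ) = 0

/-- Take φ' = x dual to q, so that u and p vanish at x. The diagonal value (x, x) gives C x = 0, and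
the relation at (φ, x) then solves for C. -/
theorem SymmetricRelation.exists_eq {A B C u p q : D →ₗ[ℝ] ℝ}
    (h : SymmetricRelation A B C u p q) (hl : LinearIndependent ℝ ![u, p, q]) :
    ∃ γ k : ℝ, ∀ φ, C φ = γ * u φ + k * p φ := by
  obtain ⟨x, hx⟩ := exists_dual_vectors hl
  have up := hx 0 1
  have uq := hx 0 2
  have pp := hx 1 1
  have pq := hx 1 2
  have qq := hx 2 2
  simp at up uq pp pq qq
  refine ⟨-A (x 2), B (x 2), fun φ => ?_⟩
  have h1 := h φ (x 2)
  have h2 := h (x 2) (x 2)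
  rw [uq, pq, qq] at h1 h2
  have h3 : C (x 2) = 0 := by linarith
  rw [h3] at h1
  linarith

/-- At (x, x) the relation gives B x = k r(x), so the multiples of p cancel in the relation at (φ,
x). No independence of r is needed, and k is carried over from C to B. -/
theorem SymmetricRelation.exists_eq_of_eq {A B C u p r : D →ₗ[ℝ] ℝ}
    (h : SymmetricRelation A B C u p r) {x : D} (hu : u x = 0) (hp : p x = 1) {γ k : ℝ}
    (hC : ∀ φ, C φ = γ * u φ + k * p φ) :
    ∃ β : ℝ, ∀ φ, B φ = β * u φ + k * r φ := by
  refine ⟨A x + γ * r x, fun φ => ?_⟩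
  have h1 := h φ x
  have h2 := h x x
  simp only [hC, hu, hp] at h1 h2
  have h3 : B x = k * r x := by linarith
  rw [h3] at h1
  linarith

end LinearAlgebra

/-! ### Test functions on the punctured space and weak derivatives -/

section TestFunctions

variable {d : ℕ}

/-- The `C¹` functions with compact support in `ℝ^d ∖ {0}`. -/
def testSpace (d : ℕ) : Submodule ℝ (Vel d → ℝ) where
  carrier := {φ | ContDiff ℝ 1 φ ∧ HasCompactSupport φ ∧ tsupport φ ⊆ {v | v ≠ 0}}
  add_mem' := fun ha hb => ⟨ha.1.add hb.1, ha.2.1.add hb.2.1,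
    (tsupport_add _ _).trans (Set.union_subset ha.2.2 hb.2.2)⟩
  zero_mem' := ⟨contDiff_const, HasCompactSupport.zero, by simp [tsupport]⟩
  smul_mem' := fun c φ h => ⟨contDiff_const.smul h.1, h.2.1.smul_left (f := fun _ => c),
    (tsupport_smul_subset_right (fun _ => c) φ).trans h.2.2⟩

theorem integrable_mul_of_tsupport_subset {f φ : Vel d → ℝ}
    (hf : LocallyIntegrableOn f {v | v ≠ 0} volume) (hφ : Continuous φ)
    (hc : HasCompactSupport φ) (hs : tsupport φ ⊆ {v | v ≠ 0}) :
    Integrable (fun v => f v * φ v) volume := by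
  have h1 : IntegrableOn (fun v => f v * φ v) (tsupport φ) :=
    (hf.integrableOn_compact_subset hs hc).mul_continuousOn hφ.continuousOn hc
  refine (integrableOn_iff_integrable_of_support_subset fun v hv => ?_).1 h1
  exact subset_tsupport _ (right_ne_zero_of_mul hv)

theorem testSpace.integrable_mul {f : Vel d → ℝ} (hf : LocallyIntegrableOn f {v | v ≠ 0} volume)
    (φ : testSpace d) : Integrable (fun v => f v * φ.1 v) volume :=
  integrable_mul_of_tsupport_subset hf φ.2.1.continuous φ.2.2.1 φ.2.2.2

theorem testSpace.integrable_mul_fderiv {f : Vel d → ℝ}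
    (hf : LocallyIntegrableOn f {v | v ≠ 0} volume) (φ : testSpace d) (e : Vel d) :
    Integrable (fun v => f v * fderiv ℝ φ.1 v e) volume :=
  integrable_mul_of_tsupport_subset hf
    ((φ.2.1.continuous_fderiv one_ne_zero).clm_apply continuous_const)
    (φ.2.2.1.fderiv_apply ℝ e) ((tsupport_fderiv_apply_subset ℝ e).trans φ.2.2.2)

theorem testSpace.differentiable (φ : testSpace d) : Differentiable ℝ φ.1 :=
  φ.2.1.differentiable one_ne_zero

/-- The functional `φ ↦ ∫ f φ` on test functions. -/
noncomputable def weakPairing {f : Vel d → ℝ} (hf : LocallyIntegrableOn f {v | v ≠ 0} volume) :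
    testSpace d →ₗ[ℝ] ℝ where
  toFun φ := ∫ v, f v * φ.1 v
  map_add' φ φ' := by
    rw [← integral_add (testSpace.integrable_mul hf φ) (testSpace.integrable_mul hf φ')]
    simp [mul_add]
  map_smul' c φ := by
    simp only [RingHom.id_apply, smul_eq_mul, ← integral_const_mul]
    refine integral_congr_ae (.of_forall fun v => ?_)
    simp only [Submodule.coe_smul, Pi.smul_apply, smul_eq_mul]
    ring

/-- The functional `φ ↦ ∫ f ∂_e φ` on test functions. -/
noncomputable def weakDeriv {f : Vel d → ℝ} (hf : LocallyIntegrableOn f {v | v ≠ 0} volume)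
    (e : Vel d) : testSpace d →ₗ[ℝ] ℝ where
  toFun φ := ∫ v, f v * fderiv ℝ φ.1 v e
  map_add' φ φ' := by
    rw [← integral_add (testSpace.integrable_mul_fderiv hf φ e)
      (testSpace.integrable_mul_fderiv hf φ' e)]
    refine integral_congr_ae (.of_forall fun v => ?_)
    simp only [Submodule.coe_add, fderiv_add (testSpace.differentiable φ v) (testSpace.differentiable φ' v),
      add_apply]
    ring
  map_smul' c φ := by
    simp only [RingHom.id_apply, smul_eq_mul, ← integral_const_mul]
    refine integral_congr_ae (.of_forall fun v => ?_)
    simp only [Submodule.coe_smul, fderiv_const_smul (testSpace.differentiable φ v), smul_apply,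
      smul_eq_mul]
    ring

theorem weakPairing_apply {f : Vel d → ℝ} (hf : LocallyIntegrableOn f {v | v ≠ 0} volume)
    (φ : testSpace d) : weakPairing hf φ = ∫ v, f v * φ.1 v := rfl

theorem weakDeriv_apply {f : Vel d → ℝ} (hf : LocallyIntegrableOn f {v | v ≠ 0} volume)
    (e : Vel d) (φ : testSpace d) : weakDeriv hf e φ = ∫ v, f v * fderiv ℝ φ.1 v e := rfl

theorem ContinuousOn.locallyIntegrableOn_ne_zero {f : Vel d → ℝ}
    (hf : ContinuousOn f {v | v ≠ 0}) : LocallyIntegrableOn f {v | v ≠ 0} volume :=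
  hf.locallyIntegrableOn isOpen_ne.measurableSet

/-- Integration by parts against test functions. -/
theorem testSpace.integral_mul_fderiv {f : Vel d → ℝ} (hf : ∀ v, v ≠ 0 → ContDiffAt ℝ 1 f v)
    (φ : testSpace d) (e : Vel d) :
    ∫ v, f v * fderiv ℝ φ.1 v e = -∫ v, fderiv ℝ f v e * φ.1 v := by
  have hfl : LocallyIntegrableOn f {v | v ≠ 0} volume :=
    ContinuousOn.locallyIntegrableOn_ne_zero fun v hv => (hf v hv).continuousAt.continuousWithinAt
  have hfl' : LocallyIntegrableOn (fun v => fderiv ℝ f v e) {v | v ≠ 0} volume :=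
    ContinuousOn.locallyIntegrableOn_ne_zero fun v hv =>
      ((((hf v hv).fderiv_right (m := 0) (by simp)).continuousAt).clm_apply
        continuousAt_const).continuousWithinAt
  refine integral_mul_fderiv_eq_neg_fderiv_mul_of_integrable (testSpace.integrable_mul hfl' φ)
    (testSpace.integrable_mul_fderiv hfl φ e) (testSpace.integrable_mul hfl φ)
    (fun v hv => (hf v (φ.2.2.2 hv)).differentiableAt one_ne_zero)
    (fun v _ => testSpace.differentiable φ v)

theorem testSpace.integral_fderiv (φ : testSpace d) (e : Vel d) :
    ∫ v, fderiv ℝ φ.1 v e = 0 := by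
  simpa using testSpace.integral_mul_fderiv (f := fun _ => 1) (fun _ _ => contDiffAt_const) φ e

theorem eq_zero_of_weakPairing_eq_zero {f : Vel d → ℝ} (hf : ContinuousOn f {v | v ≠ 0})
    (h : ∀ φ : testSpace d, ∫ v, f v * φ.1 v = 0) {v : Vel d} (hv : v ≠ 0) : f v = 0 := by
  have hae := isOpen_ne.ae_eq_zero_of_integral_contDiff_smul_eq_zero (μ := volume)
    hf.locallyIntegrableOn_ne_zero fun φ hφ hc hs => by
      simpa [mul_comm] using h ⟨φ, hφ.of_le (by simp), hc, hs⟩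
  exact Measure.eqOn_open_of_ae_eq (μ := volume) (g := fun _ => (0 : ℝ))
    ((ae_restrict_iff' isOpen_ne.measurableSet).2 hae) isOpen_ne hf continuousOn_const hv

end TestFunctions

/-! ### Separation of variables with product test functions -/

section TensorTest

variable {d : ℕ} {ω : Vel d → ℝ}

theorem continuousOn_fderiv_apply (hω : ContDiffOn ℝ 2 ω {v | v ≠ 0}) (a : Vel d) :
    ContinuousOn (fun v => fderiv ℝ ω v a) {v | v ≠ 0} := fun _ hv =>
  ((contDiffAt_fderiv hω hv).continuousAt.clm_apply continuousAt_const).continuousWithinAt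

theorem testSpace.integral_fderiv_mul_fderiv_comm (hω : ContDiffOn ℝ 2 ω {v | v ≠ 0})
    (a b : Vel d) (φ : testSpace d) :
    ∫ v, fderiv ℝ ω v a * fderiv ℝ φ.1 v b = ∫ v, fderiv ℝ ω v b * fderiv ℝ φ.1 v a := by
  have h : ∀ a v, v ≠ 0 → ContDiffAt ℝ 1 (fun v => fderiv ℝ ω v a) v := fun a v hv =>
    (contDiffAt_fderiv hω hv).clm_apply contDiffAt_const
  rw [testSpace.integral_mul_fderiv (h a), testSpace.integral_mul_fderiv (h b)]
  congr 1
  refine integral_congr_ae (.of_forall fun v => ?_)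
  beta_reduce
  by_cases hv : v = 0
  · have : φ.1 v = 0 := image_eq_zero_of_notMem_tsupport fun h => φ.2.2.2 h hv
    simp [this]
  · have hd := ((contDiffAt_fderiv hω hv).differentiableAt one_ne_zero).hasFDerivAt
    rw [(hd.clm_apply (hasFDerivAt_const a v)).fderiv,
      (hd.clm_apply (hasFDerivAt_const b v)).fderiv]
    have := ((contDiffAt_two hω hv).isSymmSndFDerivAt (by simp)).eq a b
    simp [this]

theorem collisionForm_tensor (a b : Vel d) (φ φ' : testSpace d) (z : Vel d × Vel d) :
    collisionForm ω a b (fun z => φ.1 z.1 * φ'.1 z.2) z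
      = derivDiff ω a z * (fderiv ℝ φ.1 z.1 b * φ'.1 z.2 - φ.1 z.1 * fderiv ℝ φ'.1 z.2 b)
        - derivDiff ω b z * (fderiv ℝ φ.1 z.1 a * φ'.1 z.2 - φ.1 z.1 * fderiv ℝ φ'.1 z.2 a) := by
  have h1 := (testSpace.differentiable φ z.1).hasFDerivAt.comp z hasFDerivAt_fst
  have h2 := (testSpace.differentiable φ' z.2).hasFDerivAt.comp z hasFDerivAt_snd
  have h3 : HasFDerivAt (fun z : Vel d × Vel d => φ.1 z.1 * φ'.1 z.2) _ z := h1.mul h2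
  simp only [collisionForm, h3.fderiv]
  simp
  ring

theorem tensor_mem (φ φ' : testSpace d) :
    ContDiff ℝ 1 (fun z : Vel d × Vel d => φ.1 z.1 * φ'.1 z.2) ∧
      HasCompactSupport (fun z : Vel d × Vel d => φ.1 z.1 * φ'.1 z.2) ∧
      tsupport (fun z : Vel d × Vel d => φ.1 z.1 * φ'.1 z.2) ⊆ puncturedPairs d := by
  have hsub : tsupport (fun z : Vel d × Vel d => φ.1 z.1 * φ'.1 z.2)
      ⊆ tsupport φ.1 ×ˢ tsupport φ'.1 := by
    refine closure_minimal (fun z hz => ?_) ((isClosed_tsupport _).prod (isClosed_tsupport _))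
    exact ⟨subset_tsupport _ (left_ne_zero_of_mul hz), subset_tsupport _ (right_ne_zero_of_mul hz)⟩
  refine ⟨(φ.2.1.comp contDiff_fst).mul (φ'.2.1.comp contDiff_snd), ?_, fun z hz => ?_⟩
  · exact (φ.2.2.1.prod φ'.2.2.1).of_isClosed_subset (isClosed_tsupport _) hsub
  · exact ⟨φ.2.2.2 (hsub hz).1, φ'.2.2.2 (hsub hz).2⟩

theorem locallyIntegrableOn_mul_fderiv_apply (hω : ContDiffOn ℝ 2 ω {v | v ≠ 0})
    {g : Vel d → ℝ} (hg : LocallyIntegrable g volume) (a : Vel d) :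
    LocallyIntegrableOn (fun v => g v * fderiv ℝ ω v a) {v | v ≠ 0} volume :=
  (hg.locallyIntegrableOn _).mul_continuousOn (continuousOn_fderiv_apply hω a)
    isOpen_ne.isLocallyClosed

/-- Fubini turns each term into a product of integrals. Those with a factor ∫ ∂φ' vanish, and the
two with the factor ∫ g φ cancel by symmetry of the Hessian of ω. -/
theorem integral_fst_mul_collisionForm (hω : ContDiffOn ℝ 2 ω {v | v ≠ 0}) {g : Vel d → ℝ}
    (hg : LocallyIntegrable g volume) (a b : Vel d) (φ φ' : testSpace d) :
    ∫ z : Vel d × Vel d, g z.1 * collisionForm ω a b (fun z => φ.1 z.1 * φ'.1 z.2) z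
      = ((∫ v, g v * fderiv ℝ ω v a * fderiv ℝ φ.1 v b)
          - ∫ v, g v * fderiv ℝ ω v b * fderiv ℝ φ.1 v a) * (∫ v, φ'.1 v)
        - (∫ v, g v * fderiv ℝ φ.1 v b) * (∫ v, fderiv ℝ ω v a * φ'.1 v)
        + (∫ v, g v * fderiv ℝ φ.1 v a) * (∫ v, fderiv ℝ ω v b * φ'.1 v) := by
  have hgl := hg.locallyIntegrableOn {v | v ≠ 0}
  have hgω := fun a => locallyIntegrableOn_mul_fderiv_apply hω hg a
  have hωl := fun a => (continuousOn_fderiv_apply hω a).locallyIntegrableOn_ne_zero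
  have h1l : LocallyIntegrableOn (fun _ : Vel d => (1 : ℝ)) {v | v ≠ 0} volume :=
    continuousOn_const.locallyIntegrableOn_ne_zero
  have i0 : Integrable (fun v => φ'.1 v) volume := by
    simpa using testSpace.integrable_mul h1l φ'
  have i1 : ∀ e, Integrable (fun v => fderiv ℝ φ'.1 v e) volume := fun e => by
    simpa using testSpace.integrable_mul_fderiv h1l φ' e
  have t1 := fun a b => (testSpace.integrable_mul_fderiv (hgω a) φ b).mul_prod i0
  have t2 := fun a b => (testSpace.integrable_mul_fderiv hgl φ b).mul_prod
    (testSpace.integrable_mul (hωl a) φ')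
  have t3 := fun a b => (testSpace.integrable_mul (hgω a) φ).mul_prod (i1 b)
  have t4 := fun a b => (testSpace.integrable_mul hgl φ).mul_prod
    (testSpace.integrable_mul_fderiv (hωl a) φ' b)
  have s2 : ∀ a b, Integrable (fun z : Vel d × Vel d => (g z.1 * fderiv ℝ ω z.1 a * fderiv ℝ φ.1 z.1 b) * φ'.1 z.2
      - (g z.1 * fderiv ℝ φ.1 z.1 b) * (fderiv ℝ ω z.2 a * φ'.1 z.2)) (volume.prod volume) :=
    fun a b => (t1 a b).sub (t2 a b)
  have s3 : ∀ a b, Integrable (fun z : Vel d × Vel d => (g z.1 * fderiv ℝ ω z.1 a * fderiv ℝ φ.1 z.1 b) * φ'.1 z.2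
      - (g z.1 * fderiv ℝ φ.1 z.1 b) * (fderiv ℝ ω z.2 a * φ'.1 z.2)
      - (g z.1 * fderiv ℝ ω z.1 a * φ.1 z.1) * fderiv ℝ φ'.1 z.2 b) (volume.prod volume) :=
    fun a b => (s2 a b).sub (t3 a b)
  have e : ∀ z : Vel d × Vel d, g z.1 * collisionForm ω a b (fun z => φ.1 z.1 * φ'.1 z.2) z
      = (g z.1 * fderiv ℝ ω z.1 a * fderiv ℝ φ.1 z.1 b) * φ'.1 z.2
        - (g z.1 * fderiv ℝ φ.1 z.1 b) * (fderiv ℝ ω z.2 a * φ'.1 z.2)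
        - (g z.1 * fderiv ℝ ω z.1 a * φ.1 z.1) * fderiv ℝ φ'.1 z.2 b
        + (g z.1 * φ.1 z.1) * (fderiv ℝ ω z.2 a * fderiv ℝ φ'.1 z.2 b)
        - ((g z.1 * fderiv ℝ ω z.1 b * fderiv ℝ φ.1 z.1 a) * φ'.1 z.2
        - (g z.1 * fderiv ℝ φ.1 z.1 a) * (fderiv ℝ ω z.2 b * φ'.1 z.2)
        - (g z.1 * fderiv ℝ ω z.1 b * φ.1 z.1) * fderiv ℝ φ'.1 z.2 a
        + (g z.1 * φ.1 z.1) * (fderiv ℝ ω z.2 b * fderiv ℝ φ'.1 z.2 a)) := by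
    intro z
    rw [collisionForm_tensor, derivDiff, derivDiff]
    ring
  simp only [e]
  have half : ∀ a b, ∫ z : Vel d × Vel d,
      ((g z.1 * fderiv ℝ ω z.1 a * fderiv ℝ φ.1 z.1 b) * φ'.1 z.2
        - (g z.1 * fderiv ℝ φ.1 z.1 b) * (fderiv ℝ ω z.2 a * φ'.1 z.2)
        - (g z.1 * fderiv ℝ ω z.1 a * φ.1 z.1) * fderiv ℝ φ'.1 z.2 b
        + (g z.1 * φ.1 z.1) * (fderiv ℝ ω z.2 a * fderiv ℝ φ'.1 z.2 b))
      = (∫ v, g v * fderiv ℝ ω v a * fderiv ℝ φ.1 v b) * (∫ v, φ'.1 v)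
        - (∫ v, g v * fderiv ℝ φ.1 v b) * (∫ v, fderiv ℝ ω v a * φ'.1 v)
        + (∫ v, g v * φ.1 v) * ∫ v, fderiv ℝ ω v a * fderiv ℝ φ'.1 v b := by
    intro a b
    rw [Measure.volume_eq_prod, integral_add (s3 a b) (t4 a b),
      integral_sub (s2 a b) (t3 a b), integral_sub (t1 a b) (t2 a b)]
    simp only [integral_prod_mul (fun v => g v * fderiv ℝ ω v a * fderiv ℝ φ.1 v b)
        (fun v => φ'.1 v),
      integral_prod_mul (fun v => g v * fderiv ℝ φ.1 v b) (fun v => fderiv ℝ ω v a * φ'.1 v),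
      integral_prod_mul (fun v => g v * fderiv ℝ ω v a * φ.1 v) (fun v => fderiv ℝ φ'.1 v b),
      integral_prod_mul (fun v => g v * φ.1 v) (fun v => fderiv ℝ ω v a * fderiv ℝ φ'.1 v b),
      testSpace.integral_fderiv]
    ring
  have hi : ∀ a b, Integrable (fun z : Vel d × Vel d =>
      (g z.1 * fderiv ℝ ω z.1 a * fderiv ℝ φ.1 z.1 b) * φ'.1 z.2
        - (g z.1 * fderiv ℝ φ.1 z.1 b) * (fderiv ℝ ω z.2 a * φ'.1 z.2)
        - (g z.1 * fderiv ℝ ω z.1 a * φ.1 z.1) * fderiv ℝ φ'.1 z.2 b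
        + (g z.1 * φ.1 z.1) * (fderiv ℝ ω z.2 a * fderiv ℝ φ'.1 z.2 b)) volume := fun a b =>
    (s3 a b).add (t4 a b)
  rw [integral_sub (hi a b) (hi b a), half, half,
    testSpace.integral_fderiv_mul_fderiv_comm hω a b φ']
  ring

theorem collisionForm_tensor_swap (a b : Vel d) (φ φ' : testSpace d) (z : Vel d × Vel d) :
    collisionForm ω a b (fun z => φ.1 z.1 * φ'.1 z.2) z.swap
      = collisionForm ω a b (fun z => φ'.1 z.1 * φ.1 z.2) z := by
  simp only [collisionForm_tensor, derivDiff, Prod.fst_swap, Prod.snd_swap]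
  ring

/-- Exchanging v and v_* turns the contribution of g(v_*) into that of g(v) with φ and φ' exchanged;
this produces the symmetrization. -/
theorem symmetricRelation_of_invariant (hd : 1 ≤ d) (hω : ContDiffOn ℝ 2 ω {v | v ≠ 0})
    {g : Vel d → ℝ} (hg : LocallyIntegrable g volume) (hinv : IsAECollisionInvariant ω g)
    (a b : Vel d) :
    SymmetricRelation
      (weakDeriv (locallyIntegrableOn_mul_fderiv_apply hω hg a) b
        - weakDeriv (locallyIntegrableOn_mul_fderiv_apply hω hg b) a)
      (weakDeriv (hg.locallyIntegrableOn _) b) (weakDeriv (hg.locallyIntegrableOn _) a)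
      (weakPairing (continuousOn_const (c := (1 : ℝ))).locallyIntegrableOn_ne_zero)
      (weakPairing (continuousOn_fderiv_apply hω a).locallyIntegrableOn_ne_zero)
      (weakPairing (continuousOn_fderiv_apply hω b).locallyIntegrableOn_ne_zero) := by
  intro φ φ'
  obtain ⟨h1, h2, h3⟩ := tensor_mem φ φ'
  have hG := locallyIntegrable_comp_fst_add_comp_snd hg
  have h0 := integral_mul_collisionForm_eq_zero hd hω hg hinv a b h1 h2 h3
  simp only [add_mul] at h0
  rw [integral_add (integrable_mul_collisionForm hω a b hG.1 h1 h3 h2)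
    (integrable_mul_collisionForm hω a b hG.2 h1 h3 h2)] at h0
  have hswap : ∫ z : Vel d × Vel d, g z.2 * collisionForm ω a b (fun z => φ.1 z.1 * φ'.1 z.2) z
      = ∫ z : Vel d × Vel d, g z.1 * collisionForm ω a b (fun z => φ'.1 z.1 * φ.1 z.2) z := by
    rw [Measure.volume_eq_prod, ← integral_prod_swap]
    simp only [collisionForm_tensor_swap, Prod.snd_swap]
  rw [hswap, integral_fst_mul_collisionForm hω hg, integral_fst_mul_collisionForm hω hg] at h0
  simpa only [LinearMap.sub_apply, weakDeriv_apply, weakPairing_apply, one_mul] using h0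

theorem linearIndependent_weakPairing (hω : ContDiffOn ℝ 2 ω {v | v ≠ 0}) {i j : Fin d}
    (hind : LinearIndependent ℝ ![(fun _ => 1 : {v : Vel d // v ≠ 0} → ℝ),
      partialDeriv ω i, partialDeriv ω j]) :
    LinearIndependent ℝ ![
      weakPairing (continuousOn_const (c := (1 : ℝ))).locallyIntegrableOn_ne_zero,
      weakPairing (continuousOn_fderiv_apply hω
        (EuclideanSpace.single i 1)).locallyIntegrableOn_ne_zero,
      weakPairing (continuousOn_fderiv_apply hω
        (EuclideanSpace.single j 1)).locallyIntegrableOn_ne_zero] := by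
  rw [Fintype.linearIndependent_iff] at hind ⊢
  intro c hc
  refine hind c ?_
  funext v
  have hcont : ContinuousOn (fun v => c 0 * 1 + c 1 * fderiv ℝ ω v (EuclideanSpace.single i 1)
      + c 2 * fderiv ℝ ω v (EuclideanSpace.single j 1)) {v | v ≠ 0} :=
    (continuousOn_const.add (continuousOn_const.mul (continuousOn_fderiv_apply hω _))).add
      (continuousOn_const.mul (continuousOn_fderiv_apply hω _))
  have := eq_zero_of_weakPairing_eq_zero hcont (fun φ => ?_) v.2
  · simpa [Fin.sum_univ_three, partialDeriv] using this
  · have h0 := congrArg (fun L : testSpace d →ₗ[ℝ] ℝ => L φ) hc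
    have j0 := (testSpace.integrable_mul
      (continuousOn_const (c := (1 : ℝ))).locallyIntegrableOn_ne_zero φ).const_mul (c 0)
    have j1 := (testSpace.integrable_mul (continuousOn_fderiv_apply hω
      (EuclideanSpace.single i 1)).locallyIntegrableOn_ne_zero φ).const_mul (c 1)
    have j2 := (testSpace.integrable_mul (continuousOn_fderiv_apply hω
      (EuclideanSpace.single j 1)).locallyIntegrableOn_ne_zero φ).const_mul (c 2)
    simp only [Fin.sum_univ_three, Matrix.cons_val_zero, Matrix.cons_val_one, Matrix.cons_val,
      LinearMap.add_apply, LinearMap.smul_apply, weakPairing_apply, smul_eq_mul,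
      LinearMap.zero_apply, ← integral_const_mul] at h0
    rw [← integral_add j0 j1, ← integral_add (j0.fun_add j1) j2] at h0
    rw [← h0]
    refine integral_congr_ae (.of_forall fun v => ?_)
    ring

/-- The weak gradient of a collision invariant is an affine function of `∇ω`. -/
theorem exists_weakDeriv_eq (hd : 1 ≤ d) (hω : ContDiffOn ℝ 2 ω {v | v ≠ 0})
    {i j : Fin d} (hind : LinearIndependent ℝ ![(fun _ => 1 : {v : Vel d // v ≠ 0} → ℝ),
      partialDeriv ω i, partialDeriv ω j])
    {g : Vel d → ℝ} (hg : LocallyIntegrable g volume) (hinv : IsAECollisionInvariant ω g) :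
    ∃ k : ℝ, ∀ e : Vel d, ∃ β : ℝ, ∀ φ : testSpace d,
      ∫ v, g v * fderiv ℝ φ.1 v e = β * (∫ v, φ.1 v) + k * ∫ v, fderiv ℝ ω v e * φ.1 v := by
  have hli := linearIndependent_weakPairing hω hind
  have hsym := symmetricRelation_of_invariant hd hω hg hinv
  obtain ⟨γ, k, hC⟩ := (hsym (EuclideanSpace.single i 1) (EuclideanSpace.single j 1)).exists_eq hli
  obtain ⟨x, hx⟩ := exists_dual_vectors hli
  refine ⟨k, fun e => ?_⟩
  -- The direction e_i is kept and paired with an arbitrary e, so the k found from (e_i, e_j) serves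
  -- every direction.
  obtain ⟨β, hβ⟩ := (hsym (EuclideanSpace.single i 1) e).exists_eq_of_eq
    (x := x 1) (by simpa using hx 0 1) (by simpa using hx 1 1) hC
  exact ⟨β, fun φ => by simpa [weakDeriv_apply, weakPairing_apply] using hβ φ⟩

end TensorTest

/-! ### Functions with zero weak gradient -/

section WeakGradientZero

variable {X : Type*} [NormedAddCommGroup X] [NormedSpace ℝ X] [FiniteDimensional ℝ X]
  [HasContDiffBump X] [MeasurableSpace X] [BorelSpace X] {μ : Measure X} [μ.IsAddHaarMeasure]

/-- The derivative of the mollification pairs h with the derivative of y ↦ ρ(x - y), a test function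
supported in s; testing along -e absorbs the sign. -/
theorem fderiv_convolution_normed_eq_zero {h : X → ℝ} (hh : LocallyIntegrable h μ) {s : Set X}
    (hzero : ∀ φ : X → ℝ, ContDiff ℝ 1 φ → HasCompactSupport φ → tsupport φ ⊆ s →
      ∀ e, ∫ x, h x * fderiv ℝ φ x e ∂μ = 0) (ρ : ContDiffBump (0 : X)) {x : X}
    (hx : Metric.closedBall x ρ.rOut ⊆ s) :
    HasFDerivAt (convolution (ρ.normed μ) h (ContinuousLinearMap.lsmul ℝ ℝ) μ)
      (0 : X →L[ℝ] ℝ) x := by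
  have hρ : ContDiff ℝ 1 (ρ.normed μ) := ρ.contDiff_normed
  have hd := (ρ.hasCompactSupport_normed (μ := μ)).hasFDerivAt_convolution_right
    (ContinuousLinearMap.lsmul ℝ ℝ : ℝ →L[ℝ] ℝ →L[ℝ] ℝ).flip hh hρ x
  rw [convolution_flip] at hd
  convert! hd using 1
  ext e
  rw [convolution_precompR_apply _ hh (ρ.hasCompactSupport_normed.fderiv ℝ)
    (hρ.continuous_fderiv one_ne_zero), convolution_def, zero_apply]
  have hφ : ContDiff ℝ 1 fun y => ρ.normed μ (x - y) := hρ.comp (contDiff_const.sub contDiff_id)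
  have hsupp : tsupport (fun y => ρ.normed μ (x - y)) ⊆ Metric.closedBall x ρ.rOut := by
    refine closure_minimal (fun y hy => ?_) Metric.isClosed_closedBall
    have h1 : x - y ∈ Function.support (ρ.normed μ) := hy
    rw [ρ.support_normed_eq, mem_ball_zero_iff] at h1
    rw [Metric.mem_closedBall, dist_comm, dist_eq_norm]
    exact h1.le
  have h0 := hzero _ hφ (HasCompactSupport.of_support_subset_isCompact
    (isCompact_closedBall x ρ.rOut) ((subset_tsupport _).trans hsupp)) (hsupp.trans hx) (-e)
  rw [← h0]
  refine integral_congr_ae (.of_forall fun y => ?_)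
  have hf : HasFDerivAt (fun y => ρ.normed μ (x - y)) _ y :=
    ((hρ.differentiable one_ne_zero (x - y)).hasFDerivAt).comp y ((hasFDerivAt_id y).const_sub x)
  simp only [hf.fderiv]
  simp [mul_comm]

theorem exists_ball_ae_eq_const_of_weak_gradient_eq_zero {h : X → ℝ} {Ω : Set X}
    (hΩ : IsOpen Ω) (hh : LocallyIntegrableOn h Ω μ)
    (hzero : ∀ φ : X → ℝ, ContDiff ℝ 1 φ → HasCompactSupport φ → tsupport φ ⊆ Ω →
      ∀ e, ∫ x, h x * fderiv ℝ φ x e ∂μ = 0) {x₀ : X} (hx₀ : x₀ ∈ Ω) :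
    ∃ c : ℝ, ∃ r > 0, ∀ᵐ x ∂μ, x ∈ Metric.ball x₀ r → h x = c := by
  obtain ⟨r, hr, hball⟩ := Metric.nhds_basis_closedBall.mem_iff.1 (hΩ.mem_nhds hx₀)
  set B := Metric.closedBall x₀ r with hB
  have hBm : MeasurableSet B := Metric.isClosed_closedBall.measurableSet
  -- Truncation gives a function on all of X that can be convolved, and test functions supported in
  -- B do not see it.
  set h' : X → ℝ := B.indicator h with hh'
  have hint : LocallyIntegrable h' μ := ((integrable_indicator_iff hBm).2
    (hh.integrableOn_compact_subset hball (isCompact_closedBall _ _))).locallyIntegrable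
  have hzero' : ∀ φ : X → ℝ, ContDiff ℝ 1 φ → HasCompactSupport φ → tsupport φ ⊆ B →
      ∀ e, ∫ x, h' x * fderiv ℝ φ x e ∂μ = 0 := by
    intro φ hφ hc hs e
    rw [← hzero φ hφ hc (hs.trans hball) e]
    refine integral_congr_ae (.of_forall fun x => ?_)
    by_cases hx : x ∈ B
    · simp [h', hx]
    · have : fderiv ℝ φ x = 0 := by
        rw [(notMem_tsupport_iff_eventuallyEq.1 fun h => hx (hs h)).fderiv_eq]
        simp
      simp [this]
  let ρ : ℕ → ContDiffBump (0 : X) := fun n =>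
    ⟨r / 4 / (n + 1), r / 2 / (n + 1), by positivity, by gcongr; norm_num⟩
  have hρ : Filter.Tendsto (fun n => (ρ n).rOut) Filter.atTop (𝓝 0) := by
    have := (tendsto_one_div_add_atTop_nhds_zero_nat (𝕜 := ℝ)).const_mul (r / 2)
    rw [mul_zero] at this
    refine this.congr fun n => ?_
    simp only [ρ]
    ring
  have hlim := ContDiffBump.ae_convolution_tendsto_right_of_locallyIntegrable (μ := μ) (K := 2) hρ
    (.of_forall fun n => by simp only [ρ]; apply le_of_eq; ring) hint
  have hconst : ∀ n, ∀ x ∈ Metric.ball x₀ (r / 2), ∀ y ∈ Metric.ball x₀ (r / 2),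
      convolution ((ρ n).normed μ) h' (ContinuousLinearMap.lsmul ℝ ℝ) μ x
        = convolution ((ρ n).normed μ) h' (ContinuousLinearMap.lsmul ℝ ℝ) μ y := by
    intro n x hx y hy
    have hder : ∀ z ∈ Metric.ball x₀ (r / 2), HasFDerivAt
        (convolution ((ρ n).normed μ) h' (ContinuousLinearMap.lsmul ℝ ℝ) μ)
        (0 : X →L[ℝ] ℝ) z := fun z hz => by
      refine fderiv_convolution_normed_eq_zero hint hzero' (ρ n) ?_
      refine Metric.closedBall_subset_closedBall' ?_
      have h1 : (ρ n).rOut ≤ r / 2 := div_le_self (by positivity) (by simp)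
      have h2 := Metric.mem_ball.1 hz
      linarith
    exact Metric.isOpen_ball.is_const_of_fderiv_eq_zero (convex_ball _ _).isPreconnected
      (fun z hz => (hder z hz).differentiableAt.differentiableWithinAt)
      (fun z hz => (hder z hz).fderiv) hx hy
  obtain ⟨x₁, hx₁, hx₁b⟩ : ∃ x₁, Filter.Tendsto (fun n => convolution ((ρ n).normed μ) h'
      (ContinuousLinearMap.lsmul ℝ ℝ) μ x₁) Filter.atTop (𝓝 (h' x₁)) ∧
      x₁ ∈ Metric.ball x₀ (r / 2) := by
    have hne : ∃ᵐ x ∂μ, x ∈ Metric.ball x₀ (r / 2) := by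
      rw [frequently_ae_mem_iff]
      exact (Metric.measure_ball_pos μ x₀ (by positivity)).ne'
    obtain ⟨x, hx, hxl⟩ := (hne.and_eventually hlim).exists
    exact ⟨x, hxl, hx⟩
  refine ⟨h' x₁, r / 2, by positivity, ?_⟩
  filter_upwards [hlim] with x hx hxb
  have hxB : x ∈ B := Metric.ball_subset_closedBall (Metric.ball_subset_ball (by linarith) hxb)
  have heq : h' x = h x := Set.indicator_of_mem hxB h
  rw [← heq]
  exact tendsto_nhds_unique hx (hx₁.congr fun n => hconst n x₁ hx₁b x hxb)

/-- A locally integrable function with zero weak gradient on a connected open set is almost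
everywhere constant. -/
theorem exists_ae_eq_const_of_weak_gradient_eq_zero {h : X → ℝ} {Ω : Set X}
    (hΩ : IsOpen Ω) (hconn : IsPreconnected Ω) (hh : LocallyIntegrableOn h Ω μ)
    (hzero : ∀ φ : X → ℝ, ContDiff ℝ 1 φ → HasCompactSupport φ → tsupport φ ⊆ Ω →
      ∀ e, ∫ x, h x * fderiv ℝ φ x e ∂μ = 0) :
    ∃ c : ℝ, ∀ᵐ x ∂μ, x ∈ Ω → h x = c := by
  choose! c r hr hc using fun x (hx : x ∈ Ω) =>
    exists_ball_ae_eq_const_of_weak_gradient_eq_zero hΩ hh hzero hx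
  -- Overlapping balls meet in positive measure, so their constants agree: c is locally constant on
  -- Ω, hence constant by connectedness.
  have hloc : ∀ x ∈ Ω, c =ᶠ[𝓝 x] fun _ => c x := by
    intro x hx
    filter_upwards [hΩ.mem_nhds hx, Metric.ball_mem_nhds x (hr x hx)] with y hy hyx
    have hne : ∃ᵐ z ∂μ, z ∈ Metric.ball y (r y) ∩ Metric.ball x (r x) := by
      rw [frequently_ae_mem_iff]
      exact ((Metric.isOpen_ball.inter Metric.isOpen_ball).measure_pos μ
        ⟨y, Metric.mem_ball_self (hr y hy), hyx⟩).ne'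
    obtain ⟨z, hz, h1, h2⟩ := (hne.and_eventually ((hc y hy).and (hc x hx))).exists
    rw [← h1 hz.1, ← h2 hz.2]
  have hder : ∀ x ∈ Ω, HasFDerivAt c (0 : X →L[ℝ] ℝ) x := fun x hx =>
    (hasFDerivAt_const (c x) x).congr_of_eventuallyEq (hloc x hx)
  rcases Ω.eq_empty_or_nonempty with rfl | ⟨x₁, hx₁⟩
  · exact ⟨0, by simp⟩
  refine ⟨c x₁, ?_⟩
  rw [ae_iff]
  refine measure_null_of_locally_null _ fun x hx => ?_
  have hxΩ : x ∈ Ω := by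
    by_contra hn
    exact hx fun h => absurd h hn
  have hcx : c x = c x₁ := hΩ.is_const_of_fderiv_eq_zero hconn
    (fun z hz => (hder z hz).differentiableAt.differentiableWithinAt)
    (fun z hz => (hder z hz).fderiv) hxΩ hx₁
  refine ⟨{x | ¬(x ∈ Ω → h x = c x₁)} ∩ Metric.ball x (r x),
    inter_mem_nhdsWithin _ (Metric.ball_mem_nhds x (hr x hxΩ)), ?_⟩
  refine measure_mono_null ?_ (ae_iff.1 (hc x hxΩ))
  rintro y ⟨hy, hyb⟩ hcon
  exact hy fun _ => (hcon hyb).trans hcx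

end WeakGradientZero

/-- The hypothesis `hA` is not used: the coefficients of `collisionForm` vanish off the collision
set, so that cutting off test functions near its boundary produces no boundary term, whatever the
measure of that boundary. -/
theorem theorem1p3 (d : ℕ) (hd : d = 2 ∨ d = 3)
    (ω : Vel d → ℝ) (hω : ContDiffOn ℝ 2 ω {v | v ≠ 0})
    (hind : ∃ i j : Fin d, i ≠ j ∧
      LinearIndependent ℝ ![(fun _ => 1 : {v : Vel d // v ≠ 0} → ℝ),
        partialDeriv ω i, partialDeriv ω j])
    (g : Vel d → ℝ) (hg : LocallyIntegrable g volume)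
    (hinv : IsAECollisionInvariant ω g)
    (hA : volume (frontier (collisionSet ω) ∩ puncturedPairs d) = 0) :
    ∃ (a c : ℝ) (b : Vel d), ∀ᵐ v : Vel d, v ≠ 0 →
      g v = a + inner ℝ b v + c * ω v := by
  obtain ⟨i, j, -, hli⟩ := hind
  have hd2 : 2 ≤ d := by omega
  obtain ⟨k, hk⟩ := exists_weakDeriv_eq (by omega) hω hli hg hinv
  choose β hβ using hk
  set b : Vel d := WithLp.toLp 2 fun l => β (EuclideanSpace.single l 1) with hb
  -- `hβ` says that weakly ∂_e g = -β(e) - k ∂_eω, so g + f has zero weak gradient; hence the signs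
  -- of -k and -b in the final witnesses.
  set f : Vel d → ℝ := fun v => k * ω v + inner ℝ b v with hf
  have hfC : ∀ v, v ≠ 0 → ContDiffAt ℝ 1 f v := fun v hv =>
    (contDiffAt_const.mul ((contDiffAt_two hω hv).of_le (by norm_num))).add
      (contDiffAt_const.inner ℝ contDiffAt_id)
  have hfl : LocallyIntegrableOn f {v | v ≠ 0} volume :=
    ContinuousOn.locallyIntegrableOn_ne_zero fun v hv => (hfC v hv).continuousAt.continuousWithinAt
  have hgl := hg.locallyIntegrableOn {v | v ≠ 0}
  have hfd : ∀ (l : Fin d) (v : Vel d), v ≠ 0 → fderiv ℝ f v (EuclideanSpace.single l 1)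
      = k * fderiv ℝ ω v (EuclideanSpace.single l 1) + β (EuclideanSpace.single l 1) := by
    intro l v hv
    have h1 := (((contDiffAt_two hω hv).differentiableAt two_ne_zero).hasFDerivAt).const_mul k
    have h2 : HasFDerivAt f _ v := h1.add (innerSL ℝ b).hasFDerivAt
    rw [h2.fderiv]
    simp [b, EuclideanSpace.inner_single_right]
  have hone : LocallyIntegrableOn (fun _ : Vel d => (1 : ℝ)) {v | v ≠ 0} volume :=
    continuousOn_const.locallyIntegrableOn_ne_zero
  have hbasis : ∀ (φ : testSpace d) (l : Fin d),
      ∫ v, (g v + f v) * fderiv ℝ φ.1 v (EuclideanSpace.single l 1) = 0 := by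
    intro φ l
    set e : Vel d := EuclideanSpace.single l 1 with he
    have hω1 := testSpace.integrable_mul
      (continuousOn_fderiv_apply hω e).locallyIntegrableOn_ne_zero φ
    have h1 : Integrable (fun v => φ.1 v) volume := by
      simpa using testSpace.integrable_mul hone φ
    simp only [add_mul]
    rw [integral_add (testSpace.integrable_mul_fderiv hgl φ e)
      (testSpace.integrable_mul_fderiv hfl φ e), hβ e φ, testSpace.integral_mul_fderiv hfC]
    have h2 : ∫ v, fderiv ℝ f v e * φ.1 v
        = ∫ v, (k * (fderiv ℝ ω v e * φ.1 v) + β e * φ.1 v) := by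
      refine integral_congr_ae (.of_forall fun v => ?_)
      beta_reduce
      by_cases hv : v = 0
      · have : φ.1 v = 0 := image_eq_zero_of_notMem_tsupport fun h => φ.2.2.2 h hv
        simp [this]
      · rw [he, hfd l v hv]
        ring
    rw [h2, integral_add (hω1.const_mul k) (h1.const_mul (β e)), integral_const_mul,
      integral_const_mul]
    ring
  obtain ⟨a, ha⟩ := exists_ae_eq_const_of_weak_gradient_eq_zero (μ := volume)
    (Ω := {v : Vel d | v ≠ 0}) isOpen_ne (by
      -- Removing a point keeps ℝ^d connected because d ≥ 2.
      have hrank : 1 < Module.rank ℝ (Vel d) := by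
        rw [← Module.finrank_eq_rank, finrank_euclideanSpace_fin]
        exact_mod_cast hd2
      exact (isConnected_compl_singleton_of_one_lt_rank hrank 0).isPreconnected)
    (hgl.add hfl) (fun φ hφ hc hs e => by
      set φ' : testSpace d := ⟨φ, hφ, hc, hs⟩
      have hexp : ∀ v, (g + f) v * fderiv ℝ φ v e
          = ∑ l, e l * ((g v + f v) * fderiv ℝ φ v (EuclideanSpace.single l 1)) := by
        intro v
        conv_lhs => rw [← (EuclideanSpace.basisFun (Fin d) ℝ).sum_repr e]
        simp only [map_sum, map_smul, Finset.mul_sum, EuclideanSpace.basisFun_repr,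
          EuclideanSpace.basisFun_apply, smul_eq_mul, Pi.add_apply]
        exact Finset.sum_congr rfl fun l _ => by ring
      simp only [hexp]
      rw [integral_finsetSum]
      · refine Finset.sum_eq_zero fun l _ => ?_
        rw [integral_const_mul, hbasis φ' l, mul_zero]
      · exact fun l _ => (testSpace.integrable_mul_fderiv (hgl.add hfl) φ' _).const_mul _)
  refine ⟨a, -k, -b, ?_⟩
  filter_upwards [ha] with v hv hv0
  have := hv hv0
  simp only [Pi.add_apply, hf] at this
  rw [inner_neg_left]
  linarith
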